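/- Let $\Bbbk$ be a commutative ring and let $\mathcal C$ be a spherical fusion category over $\Bbbk$. That is: $\mathcal C$ is a $\Bbbk$-linear category with finite direct sums and a monoidal structure whose tensor product is $\Bbbk$-bilinear; every object $X$ has a dual $X^*$ with evaluation $\mathrm{ev}_X\colon X^*\otimes X\to\mathbb 1$ and coevaluation $\mathrm{coev}_X\colon\mathbb 1\to X\otimes X^*$; $\mathcal C$ is endowed with a monoidal natural isomorphism $\phi_X\colon X\to X^{**}$; there is a finite family $(V_i)_{i\in I}$ of objects such that $\mathrm{End}(V_i)=\Bbbk\,\mathrm{id}_{V_i}$ is free of rank one, $\mathrm{Hom}(V_i,V_j)=0$ for $i\neq j$, every object is a finite direct sum of objects of the family, and $\mathbb 1$ is isomorphic to some $V_0$, $0 \in I$; and for every endomorphism $f\colon X\to X$ the left trace $\mathrm{tr}_l(f)=\mathrm{ev}_X(\mathrm{id}_{X^*}\otimes f\phi_X^{-1})\mathrm{coev}_{X^*}$ equals the right trace $\mathrm{tr}_r(f)=\mathrm{ev}_{X^*}(\phi_Xf\otimes\mathrm{id}_{X^*})\mathrm{coev}_X$. Both traces lie in $\mathrm{End}(\mathbb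 1)=\Bbbk$. Put $$\dim\mathcal C=\sum_{i\in I}\dim_l(V_i)\dim_r(V_i)\in\Bbbk,\qquad \dim_l(X)=\mathrm{tr}_l(\mathrm{id}_X),\quad \dim_r(X)=\mathrm{tr}_r(\mathrm{id}_X).$$ Let $Z$ be the monad on $\mathcal C$ given by the coend $$Z(X)=\int^{Y\in\mathcal C}Y^*\otimes X\otimes Y=\bigoplus_{i\in I}V_i^*\otimes X\otimes V_i ,$$ with universal dinatural transformation $i_{X,Y}=\sum_a q_a^*\otimes\mathrm{id}_X\otimes p_a\colon Y^*\otimes X\otimes Y\to Z(X)$, where $p_a\colon Y\to V_{i_a}$ and $q_a\colon V_{i_a}\to Y$ are the projections and inclusions of a decomposition of $Y$ into a direct sum of objects of the family. Its unit is $\eta_X=i_{X,\mathbb 1}$ (with $\mathbb 1^*\otimes X\otimes\mathbb 1\cong X$), and its multiplication $\mu$ is determined by $$\mu_X\, i_{Z(X),Y_2}(\mathrm{id}_{Y_2^*}\otimes i_{X,Y_1}\otimes\mathrm{id}_{Y_2})=i_{X,Y_1\otimes Y_2}$$ (with $Y_2^*\otimes Y_1^*\cong(Y_1\otimes Y_2)^*$).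 This is the monad underlying the ribbon Hopf monad whose category of modules is the center $\mathcal Z(\mathcal C)$. Then $Z$ is semisimple, in the sense that every $Z$-module $(M,r\colon Z(M)\to M)$ is a $Z$-linear retract of a free $Z$-module $(Z(X),\mu_X)$ for some object $X$ of $\mathcal C$, if and only if $\dim\mathcal C$ is invertible in $\Bbbk$. -/

import Mathlib

open CategoryTheory CategoryTheory.Limits CategoryTheory.MonoidalCategory

universe w v u

set_option linter.unusedSectionVars false

noncomputable section

namespace SphericalFusion

section Duality

variable {C : Type u} [Category.{v} C] [MonoidalCategory C] [RightRigidCategory C]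

/-- The chosen dual `X*` of `X`, with evaluation `X* ⊗ X ⟶ 𝟙` and coevaluation `𝟙 ⟶ X ⊗ X*`.
This is called the *left* dual by Bruguières and Virelizier and the *right* dual in Mathlib. -/
def dual (X : C) : C := Xᘁ

/-- The evaluation `X* ⊗ X ⟶ 𝟙`. -/
def ev (X : C) : dual X ⊗ X ⟶ 𝟙_ C := ε_ X Xᘁ

/-- The coevaluation `𝟙 ⟶ X ⊗ X*`. -/
def coev (X : C) : 𝟙_ C ⟶ X ⊗ dual X := η_ X Xᘁ

/-- The dual `f* : Y* ⟶ X*` of a morphism `f : X ⟶ Y`. -/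
def dualMap {X Y : C} (f : X ⟶ Y) : dual Y ⟶ dual X := fᘁ

/-- The morphism `A ⟶ Y*` that corresponds to a pairing `A ⊗ Y ⟶ 𝟙`. -/
def toDual {A Y : C} (e : A ⊗ Y ⟶ 𝟙_ C) : A ⟶ dual Y :=
  (ρ_ A).inv ≫ A ◁ coev Y ≫ (α_ A Y (dual Y)).inv ≫ e ▷ dual Y ≫ (λ_ (dual Y)).hom

/-- The canonical isomorphism `𝟙 ⟶ 𝟙*`. -/
def dualUnit : 𝟙_ C ⟶ dual (𝟙_ C) := toDual (λ_ (𝟙_ C)).hom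

/-- The nested evaluation `(Y* ⊗ X*) ⊗ (X ⊗ Y) ⟶ 𝟙`. -/
def evNested (X Y : C) : (dual Y ⊗ dual X) ⊗ (X ⊗ Y) ⟶ 𝟙_ C :=
  𝟙 _ ⊗≫ dual Y ◁ (ev X ▷ Y) ⊗≫ ev Y

/-- The canonical isomorphism `Y* ⊗ X* ⟶ (X ⊗ Y)*`. -/
def dualTensor (X Y : C) : dual Y ⊗ dual X ⟶ dual (X ⊗ Y) := toDual (evNested X Y)

lemma toDual_eq {A Y : C} (e : A ⊗ Y ⟶ 𝟙_ C) :
    toDual e = tensorRightHomEquiv A Y Yᘁ (𝟙_ C) e ≫ (λ_ _).hom := by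
  simp [toDual, tensorRightHomEquiv, dual, coev]

lemma toDual_of_ev {A Y : C} (f : A ⟶ dual Y) : toDual (f ▷ Y ≫ ev Y) = f := by
  rw [toDual_eq]
  refine (congrArg (fun g => g ≫ (λ_ (dual Y)).hom)
    (tensorRightHomEquiv_whiskerRight_comp_evaluation (X := Y) (Y := A) f)).trans ?_
  exact (Category.assoc _ _ _).trans ((congrArg (f ≫ ·) (Iso.inv_hom_id _)).trans
    (Category.comp_id _))

lemma dual_hom_ext {A Y : C} {f g : A ⟶ dual Y} (h : f ▷ Y ≫ ev Y = g ▷ Y ≫ ev Y) : f = g := by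
  rw [← toDual_of_ev f, h, toDual_of_ev]

lemma toDual_ev {A Y : C} (e : A ⊗ Y ⟶ 𝟙_ C) : toDual e ▷ Y ≫ ev Y = e := by
  have inj : ∀ a b : A ⊗ Y ⟶ 𝟙_ C, toDual a = toDual b → a = b := by
    intro a b h
    rw [toDual_eq, toDual_eq] at h
    exact (tensorRightHomEquiv A Y Yᘁ (𝟙_ C)).injective ((cancel_mono _).1 h)
  exact inj _ _ (toDual_of_ev _)

lemma dualMap_ev {X Y : C} (f : X ⟶ Y) : dualMap f ▷ X ≫ ev X = dual Y ◁ f ≫ ev Y :=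
  rightAdjointMate_comp_evaluation f

lemma dualMap_id (X : C) : dualMap (𝟙 X) = 𝟙 (dual X) := rightAdjointMate_id

lemma dualMap_comp {X Y Z : C} (f : X ⟶ Y) (g : Y ⟶ Z) :
    dualMap (f ≫ g) = dualMap g ≫ dualMap f := comp_rightAdjointMate

lemma dualTensor_ev (X Y : C) : dualTensor X Y ▷ (X ⊗ Y) ≫ ev (X ⊗ Y) = evNested X Y :=
  toDual_ev _

lemma dualUnit_ev : dualUnit ▷ (𝟙_ C) ≫ ev (𝟙_ C) = (λ_ (𝟙_ C)).hom := toDual_ev _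

lemma dualTensor_nat_left {Y Y' : C} (g : Y ⟶ Y') (Z : C) :
    dual Z ◁ dualMap g ≫ dualTensor Y Z = dualTensor Y' Z ≫ dualMap (g ▷ Z) := by
  apply dual_hom_ext
  simp only [comp_whiskerRight, Category.assoc]
  rw [dualMap_ev, dualTensor_ev, ← whisker_exchange_assoc, dualTensor_ev]
  simp only [evNested]
  calc _ = 𝟙 _ ⊗≫ dual Z ◁ (dualMap g ▷ Y ≫ ev Y) ▷ Z ⊗≫ ev Z := by monoidal
    _ = _ := by rw [dualMap_ev]; monoidal

lemma dualTensor_nat_right (Z : C) {Y Y' : C} (g : Y ⟶ Y') :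
    dualMap g ▷ dual Z ≫ dualTensor Z Y = dualTensor Z Y' ≫ dualMap (Z ◁ g) := by
  apply dual_hom_ext
  simp only [comp_whiskerRight, Category.assoc]
  rw [dualMap_ev, dualTensor_ev, ← whisker_exchange_assoc, dualTensor_ev]
  simp only [evNested]
  calc _ = 𝟙 _ ⊗≫ (dualMap g ▷ (dual Z ⊗ Z) ≫ dual Y ◁ ev Z) ▷ Y ⊗≫ ev Y := by monoidal
    _ = 𝟙 _ ⊗≫ dual Y' ◁ ev Z ▷ Y ⊗≫ (dualMap g ▷ Y ≫ ev Y) := by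
        rw [← whisker_exchange]; monoidal
    _ = 𝟙 _ ⊗≫ dual Y' ◁ (ev Z ▷ Y ≫ 𝟙_ C ◁ g) ⊗≫ ev Y' := by rw [dualMap_ev]; monoidal
    _ = _ := by rw [← whisker_exchange]; monoidal

lemma dualTensor_assoc (X Y Z : C) :
    dual Z ◁ dualTensor X Y ≫ dualTensor (X ⊗ Y) Z =
      (α_ _ _ _).inv ≫ dualTensor Y Z ▷ dual X ≫ dualTensor X (Y ⊗ Z) ≫
        dualMap (α_ X Y Z).hom := by
  apply dual_hom_ext
  have e1 : (dual Z ◁ dualTensor X Y ≫ dualTensor (X ⊗ Y) Z) ▷ ((X ⊗ Y) ⊗ Z) ≫ ev ((X ⊗ Y) ⊗ Z) =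
      𝟙 _ ⊗≫ dual Z ◁ (evNested X Y) ▷ Z ⊗≫ ev Z := by
    rw [comp_whiskerRight, Category.assoc, dualTensor_ev, ← dualTensor_ev X Y]
    simp only [evNested]
    monoidal
  have e2 : ((α_ _ _ _).inv ≫ dualTensor Y Z ▷ dual X ≫ dualTensor X (Y ⊗ Z) ≫
        dualMap (α_ X Y Z).hom) ▷ ((X ⊗ Y) ⊗ Z) ≫ ev ((X ⊗ Y) ⊗ Z) =
      𝟙 _ ⊗≫ (dual Z ⊗ dual Y) ◁ ev X ▷ (Y ⊗ Z) ⊗≫ evNested Y Z := by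
    simp only [comp_whiskerRight, Category.assoc]
    rw [dualMap_ev, ← whisker_exchange_assoc, ← whisker_exchange_assoc, dualTensor_ev,
      ← dualTensor_ev Y Z]
    simp only [evNested]
    calc _ = 𝟙 _ ⊗≫ (dualTensor Y Z ▷ (dual X ⊗ X) ≫ dual (Y ⊗ Z) ◁ ev X) ▷ (Y ⊗ Z) ⊗≫
            ev (Y ⊗ Z) := by monoidal
      _ = _ := by rw [← whisker_exchange]; monoidal
  rw [e1, e2]
  simp only [evNested]
  monoidal

lemma dualTensor_unit_right (Y : C) :
    (λ_ (dual Y)).inv ≫ dualUnit ▷ dual Y ≫ dualTensor Y (𝟙_ C) = dualMap (ρ_ Y).hom := by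
  apply dual_hom_ext
  simp only [comp_whiskerRight, Category.assoc]
  rw [dualTensor_ev, dualMap_ev]
  simp only [evNested]
  calc _ = 𝟙 _ ⊗≫ (dualUnit ▷ (dual Y ⊗ Y) ≫ dual (𝟙_ C) ◁ ev Y) ▷ 𝟙_ C ⊗≫ ev (𝟙_ C) := by
        monoidal
    _ = 𝟙 _ ⊗≫ ev Y ⊗≫ (dualUnit ▷ 𝟙_ C ≫ ev (𝟙_ C)) := by
        rw [← whisker_exchange]; monoidal
    _ = _ := by rw [dualUnit_ev]; monoidal

lemma dualTensor_unit_left (Y : C) :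
    (ρ_ (dual Y)).inv ≫ dual Y ◁ dualUnit ≫ dualTensor (𝟙_ C) Y = dualMap (λ_ Y).hom := by
  apply dual_hom_ext
  simp only [comp_whiskerRight, Category.assoc]
  rw [dualTensor_ev, dualMap_ev]
  simp only [evNested]
  calc _ = 𝟙 _ ⊗≫ dual Y ◁ (dualUnit ▷ 𝟙_ C ≫ ev (𝟙_ C)) ▷ Y ⊗≫ ev Y := by monoidal
    _ = _ := by rw [dualUnit_ev]; monoidal

lemma dualMap_sum [Preadditive C] [MonoidalPreadditive C]
    {α : Type*} (s : Finset α) {X Y : C} (f : α → (X ⟶ Y)) :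
    dualMap (∑ a ∈ s, f a) = ∑ a ∈ s, dualMap (f a) := by
  apply dual_hom_ext
  rw [dualMap_ev, CategoryTheory.whiskerLeft_sum, CategoryTheory.sum_whiskerRight,
    Preadditive.sum_comp, Preadditive.sum_comp]
  exact Finset.sum_congr rfl fun a _ => (dualMap_ev (f a)).symm

end Duality

section Sovereign

variable (C : Type u) [Category.{v} C] [MonoidalCategory C] [RightRigidCategory C]

/-- A sovereign structure: a monoidal natural isomorphism from the identity to the double dual. -/
structure SovereignStructure where
  /-- the isomorphism `X ≅ X**` -/
  φ : ∀ X : C, X ≅ dual (dual X)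
  naturality : ∀ {X Y : C} (f : X ⟶ Y), f ≫ (φ Y).hom = (φ X).hom ≫ dualMap (dualMap f)
  tensor : ∀ X Y : C, (φ (X ⊗ Y)).hom ≫ dualMap (dualTensor X Y) =
    ((φ X).hom ⊗ₘ (φ Y).hom) ≫ dualTensor (dual Y) (dual X)
  unit : (φ (𝟙_ C)).hom ≫ dualMap (dualUnit (C := C)) = dualUnit

namespace SovereignStructure

variable {C}
variable (S : SovereignStructure C)

/-- The left trace `𝟙 ⟶ X* ⊗ X** ⟶ X* ⊗ X ⟶ X* ⊗ X ⟶ 𝟙` of `f : X ⟶ X`. -/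
def leftTrace {X : C} (f : X ⟶ X) : 𝟙_ C ⟶ 𝟙_ C :=
  coev (dual X) ≫ dual X ◁ ((S.φ X).inv ≫ f) ≫ ev X

/-- The right trace `𝟙 ⟶ X ⊗ X* ⟶ X ⊗ X* ⟶ X** ⊗ X* ⟶ 𝟙` of `f : X ⟶ X`. -/
def rightTrace {X : C} (f : X ⟶ X) : 𝟙_ C ⟶ 𝟙_ C :=
  coev X ≫ (f ≫ (S.φ X).hom) ▷ dual X ≫ ev (dual X)

/-- A sovereign structure is spherical if left and right traces of endomorphisms coincide. -/
def IsSpherical : Prop := ∀ (X : C) (f : X ⟶ X), S.leftTrace f = S.rightTrace f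

end SovereignStructure

end Sovereign

section Fusion

variable (k : Type w) [CommRing k] {C : Type u} [Category.{v} C] [Preadditive C] [Linear k C]
  [HasFiniteBiproducts C] [MonoidalCategory C] {ι : Type*}

/-- The family `V` makes the `k`-linear category `C` into a fusion category: `Hom (V i) (V j)` is
`k` for `i = j` (freely generated by the identity) and `0` otherwise, every object is a finite
direct sum of members of `V`, and the unit object is isomorphic to a member of `V`. -/
structure IsFusionFamily (V : ι → C) : Prop where
  end_bijective : ∀ i, Function.Bijective (fun c : k => c • 𝟙 (V i))
  hom_eq_zero : ∀ i j, i ≠ j → ∀ f : V i ⟶ V j, f = 0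
  exists_sum : ∀ X : C, ∃ (n : ℕ) (s : Fin n → ι), Nonempty (X ≅ ⨁ fun a => V (s a))
  exists_unit : ∃ i, Nonempty (𝟙_ C ≅ V i)

variable {k} {V : ι → C}

namespace IsFusionFamily

/-- The number of summands in a chosen decomposition of `X` into members of `V`. -/
def num (hV : IsFusionFamily k V) (X : C) : ℕ := (hV.exists_sum X).choose

/-- The labels of the summands in a chosen decomposition of `X`. -/
def label (hV : IsFusionFamily k V) (X : C) : Fin (hV.num X) → ι :=
  (hV.exists_sum X).choose_spec.choose

/-- A chosen decomposition of `X`. -/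
def decomp (hV : IsFusionFamily k V) (X : C) : X ≅ ⨁ fun a => V (hV.label X a) :=
  (hV.exists_sum X).choose_spec.choose_spec.some

/-- The projection `X ⟶ V (label a)` of the chosen decomposition of `X`. -/
def p (hV : IsFusionFamily k V) (X : C) (a : Fin (hV.num X)) : X ⟶ V (hV.label X a) :=
  (hV.decomp X).hom ≫ biproduct.π (fun a => V (hV.label X a)) a

/-- The inclusion `V (label a) ⟶ X` of the chosen decomposition of `X`. -/
def q (hV : IsFusionFamily k V) (X : C) (a : Fin (hV.num X)) : V (hV.label X a) ⟶ X :=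
  biproduct.ι (fun a => V (hV.label X a)) a ≫ (hV.decomp X).inv

lemma sum_p_q (hV : IsFusionFamily k V) (X : C) : ∑ a, hV.p X a ≫ hV.q X a = 𝟙 X := by
  have h : ∑ a, hV.p X a ≫ hV.q X a = (hV.decomp X).hom ≫
      (∑ a, biproduct.π (fun a => V (hV.label X a)) a ≫
        biproduct.ι (fun a => V (hV.label X a)) a) ≫ (hV.decomp X).inv := by
    simp only [p, q, Preadditive.sum_comp, Preadditive.comp_sum, Category.assoc]
  rw [h, biproduct.total]
  simp

lemma unit_bijective (hV : IsFusionFamily k V) :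
    Function.Bijective (fun c : k => c • 𝟙 (𝟙_ C)) := by
  obtain ⟨i, ⟨e⟩⟩ := hV.exists_unit
  constructor
  · intro a b h
    apply (hV.end_bijective i).1
    have := congrArg (fun g => e.inv ≫ g ≫ e.hom) h
    simpa using this
  · intro f
    obtain ⟨c, hc⟩ := (hV.end_bijective i).2 (e.inv ≫ f ≫ e.hom)
    refine ⟨c, ?_⟩
    have := congrArg (fun g => e.hom ≫ g ≫ e.inv) hc
    simpa using this

/-- The identification of `End (𝟙)` with `k`, inverse to `c ↦ c • 𝟙`. -/
def scalar (hV : IsFusionFamily k V) (f : 𝟙_ C ⟶ 𝟙_ C) : k :=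
  (Equiv.ofBijective _ hV.unit_bijective).symm f

end IsFusionFamily

/-- The dimension `∑ i, dim_l (V i) * dim_r (V i)` of a sovereign fusion category, as a scalar. -/
def SovereignStructure.dim [RightRigidCategory C] [Fintype ι] (S : SovereignStructure C)
    (hV : IsFusionFamily k V) : k :=
  ∑ i, hV.scalar (S.leftTrace (𝟙 (V i))) * hV.scalar (S.rightTrace (𝟙 (V i)))

end Fusion

section Centralizer

variable {k : Type w} [CommRing k] {C : Type u} [Category.{v} C] [Preadditive C] [Linear k C]
  [HasFiniteBiproducts C] [MonoidalCategory C] [MonoidalPreadditive C] [MonoidalLinear k C]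
  [RightRigidCategory C] {ι : Type*} [Fintype ι] {V : ι → C}

variable (V) in
/-- The object `Z(X) = ⨁ i, V_i* ⊗ X ⊗ V_i`. -/
def Zobj (X : C) : C := ⨁ fun i => dual (V i) ⊗ (X ⊗ V i)

variable (V) in
/-- The inclusion of the `i`-th summand of `Z(X)`. -/
def Zι (X : C) (i : ι) : dual (V i) ⊗ (X ⊗ V i) ⟶ Zobj V X :=
  biproduct.ι (fun i => dual (V i) ⊗ (X ⊗ V i)) i

variable (V) in
/-- The projection to the `i`-th summand of `Z(X)`. -/
def Zπ (X : C) (i : ι) : Zobj V X ⟶ dual (V i) ⊗ (X ⊗ V i) :=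
  biproduct.π (fun i => dual (V i) ⊗ (X ⊗ V i)) i

variable (V) in
/-- The functor `Z` on morphisms. -/
def Zmap {X X' : C} (f : X ⟶ X') : Zobj V X ⟶ Zobj V X' :=
  biproduct.map fun i => dual (V i) ◁ (f ▷ V i)

/-- The universal dinatural transformation
`i_{X,Y} = ∑ a, q_a* ⊗ X ⊗ p_a : Y* ⊗ X ⊗ Y ⟶ Z(X)`, where `p_a : Y ⟶ V_i` and `q_a : V_i ⟶ Y` are
the projections and inclusions of a decomposition of `Y`. -/
def dinat (hV : IsFusionFamily k V) (X Y : C) : dual Y ⊗ (X ⊗ Y) ⟶ Zobj V X :=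
  ∑ a, (dualMap (hV.q Y a) ⊗ₘ (X ◁ hV.p Y a)) ≫ Zι V X (hV.label Y a)

lemma dualMap_smul (c : k) {X Y : C} (f : X ⟶ Y) : dualMap (c • f) = c • dualMap f := by
  apply dual_hom_ext
  rw [dualMap_ev, MonoidalLinear.whiskerLeft_smul, MonoidalLinear.smul_whiskerRight,
    Linear.smul_comp, Linear.smul_comp, dualMap_ev]

lemma dualMap_zero (X Y : C) : dualMap (0 : X ⟶ Y) = 0 := by
  apply dual_hom_ext
  rw [dualMap_ev, MonoidalPreadditive.whiskerLeft_zero, MonoidalPreadditive.zero_whiskerRight,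
    zero_comp, zero_comp]

lemma Zι_dinatural (hV : IsFusionFamily k V) (X : C) {i j : ι} (h : V i ⟶ V j) :
    dualMap h ▷ (X ⊗ V i) ≫ Zι V X i = dual (V j) ◁ (X ◁ h) ≫ Zι V X j := by
  by_cases hij : i = j
  · subst hij
    obtain ⟨c, rfl⟩ := (hV.end_bijective i).2 h
    simp only [dualMap_smul, dualMap_id, MonoidalLinear.whiskerLeft_smul,
      MonoidalLinear.smul_whiskerRight, Linear.smul_comp, id_whiskerRight,
      MonoidalCategory.whiskerLeft_id]
  · rw [hV.hom_eq_zero i j hij h, dualMap_zero]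
    simp

/-- A family `d_Y : F(Y* ⊗ X ⊗ Y) ⟶ D` is dinatural. -/
def IsDinatural (F : C ⥤ C) (X : C) {D : C} (d : ∀ Y : C, F.obj (dual Y ⊗ (X ⊗ Y)) ⟶ D) : Prop :=
  ∀ ⦃Y Y' : C⦄ (g : Y ⟶ Y'),
    F.map (dualMap g ▷ (X ⊗ Y)) ≫ d Y = F.map (dual Y' ◁ (X ◁ g)) ≫ d Y'

variable (V) in
lemma Zι_π (X : C) (i : ι) : Zι V X i ≫ Zπ V X i = 𝟙 _ :=
  biproduct.ι_π_self (fun i => dual (V i) ⊗ (X ⊗ V i)) i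

variable (V) in
lemma Zι_π_ne (X : C) {i j : ι} (h : i ≠ j) : Zι V X i ≫ Zπ V X j = 0 :=
  biproduct.ι_π_ne (fun i => dual (V i) ⊗ (X ⊗ V i)) h

variable (V) in
lemma Z_total (X : C) : ∑ i, Zπ V X i ≫ Zι V X i = 𝟙 (Zobj V X) := by
  refine biproduct.hom_ext' _ _ fun j => ?_
  change Zι V X j ≫ _ = Zι V X j ≫ _
  rw [Preadditive.comp_sum, Finset.sum_eq_single j, ← Category.assoc, Zι_π, Category.id_comp,
    Category.comp_id]
  · intro i _ hij
    rw [← Category.assoc, Zι_π_ne V X hij.symm, zero_comp]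
  · simp

lemma dinat_eq (hV : IsFusionFamily k V) (X Y : C) :
    dinat hV X Y = ∑ a, dual Y ◁ (X ◁ hV.p Y a) ≫ dualMap (hV.q Y a) ▷ _ ≫
      Zι V X (hV.label Y a) := by
  simp only [dinat, tensorHom_def', Category.assoc]

lemma dinat_simple (hV : IsFusionFamily k V) (X : C) (i : ι) :
    dinat hV X (V i) = Zι V X i := by
  have h : ∀ a, dual (V i) ◁ (X ◁ hV.p (V i) a) ≫ dualMap (hV.q (V i) a) ▷ _ ≫
      Zι V X (hV.label (V i) a) = dual (V i) ◁ (X ◁ (hV.p (V i) a ≫ hV.q (V i) a)) ≫ Zι V X i := by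
    intro a
    rw [Zι_dinatural hV X (hV.q (V i) a)]
    simp
  rw [dinat_eq, Finset.sum_congr rfl fun a _ => h a, ← Preadditive.sum_comp,
    ← CategoryTheory.whiskerLeft_sum, ← CategoryTheory.whiskerLeft_sum, hV.sum_p_q]
  simp

lemma dinat_desc (hV : IsFusionFamily k V) (F : C ⥤ C) [F.Additive] (X : C) {D : C}
    (d : ∀ Y : C, F.obj (dual Y ⊗ (X ⊗ Y)) ⟶ D) (hd : IsDinatural F X d) (Y : C) :
    F.map (dinat hV X Y) ≫ ∑ i, F.map (Zπ V X i) ≫ d (V i) = d Y := by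
  have h1 : ∀ j, F.map (Zι V X j) ≫ ∑ i, F.map (Zπ V X i) ≫ d (V i) = d (V j) := by
    intro j
    rw [Preadditive.comp_sum, Finset.sum_eq_single j]
    · rw [← F.map_comp_assoc, Zι_π]
      simp
    · intro i _ hij
      rw [← F.map_comp_assoc, Zι_π_ne V X hij.symm]
      simp
    · simp
  rw [dinat_eq, F.map_sum, Preadditive.sum_comp]
  simp only [F.map_comp, Category.assoc, h1]
  simp only [hd (hV.q Y _)]
  simp only [← F.map_comp_assoc]
  rw [← Preadditive.sum_comp, ← F.map_sum]
  simp only [← MonoidalCategory.whiskerLeft_comp]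
  rw [← CategoryTheory.whiskerLeft_sum, ← CategoryTheory.whiskerLeft_sum, hV.sum_p_q]
  simp

lemma dinat_hom_ext (hV : IsFusionFamily k V) (F : C ⥤ C) [F.Additive] (X : C) {D : C}
    {f g : F.obj (Zobj V X) ⟶ D} (h : ∀ Y, F.map (dinat hV X Y) ≫ f = F.map (dinat hV X Y) ≫ g) :
    f = g := by
  have e : ∑ i, F.map (Zπ V X i) ≫ F.map (dinat hV X (V i)) = 𝟙 (F.obj (Zobj V X)) := by
    simp only [dinat_simple, ← F.map_comp, ← F.map_sum]
    rw [Z_total, F.map_id]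
  rw [← Category.id_comp f, ← Category.id_comp g, ← e, Preadditive.sum_comp, Preadditive.sum_comp]
  simp only [Category.assoc, h]

lemma dinat_dinatural (hV : IsFusionFamily k V) (X : C) {Y Y' : C} (g : Y ⟶ Y') :
    dualMap g ▷ (X ⊗ Y) ≫ dinat hV X Y = dual Y' ◁ (X ◁ g) ≫ dinat hV X Y' := by
  have hl : ∀ a, dualMap g ▷ (X ⊗ Y) ≫ dual Y ◁ (X ◁ hV.p Y a) ≫ dualMap (hV.q Y a) ▷ _ ≫
      Zι V X (hV.label Y a) = ∑ b, dual Y' ◁ (X ◁ (hV.p Y a ≫ hV.q Y a ≫ g ≫ hV.p Y' b)) ≫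
        dualMap (hV.q Y' b) ▷ _ ≫ Zι V X (hV.label Y' b) := by
    intro a
    rw [← whisker_exchange_assoc, ← comp_whiskerRight_assoc, ← dualMap_comp]
    have e : hV.q Y a ≫ g = ∑ b, (hV.q Y a ≫ g ≫ hV.p Y' b) ≫ hV.q Y' b := by
      simp only [Category.assoc]
      rw [← Preadditive.comp_sum, ← Preadditive.comp_sum, hV.sum_p_q, Category.comp_id]
    rw [e, dualMap_sum, CategoryTheory.sum_whiskerRight, Preadditive.sum_comp,
      Preadditive.comp_sum]
    refine Finset.sum_congr rfl fun b _ => ?_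
    rw [dualMap_comp, comp_whiskerRight, Category.assoc, Zι_dinatural hV,
      ← whisker_exchange_assoc]
    simp only [MonoidalCategory.whiskerLeft_comp, Category.assoc]
  rw [dinat_eq, dinat_eq, Preadditive.comp_sum, Preadditive.comp_sum,
    Finset.sum_congr rfl fun a _ => hl a, Finset.sum_comm]
  refine Finset.sum_congr rfl fun b _ => ?_
  rw [← Preadditive.sum_comp, ← CategoryTheory.whiskerLeft_sum, ← CategoryTheory.whiskerLeft_sum]
  simp only [← Category.assoc (hV.p Y _) (hV.q Y _)]
  rw [← Preadditive.sum_comp, hV.sum_p_q]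
  simp only [Category.id_comp, MonoidalCategory.whiskerLeft_comp, Category.assoc]

lemma dinat_naturality (hV : IsFusionFamily k V) {X X' : C} (f : X ⟶ X') (Y : C) :
    dinat hV X Y ≫ Zmap V f = dual Y ◁ (f ▷ Y) ≫ dinat hV X' Y := by
  have h : ∀ i, Zι V X i ≫ Zmap V f = dual (V i) ◁ (f ▷ V i) ≫ Zι V X' i := fun i => biproduct.ι_map
      (f := fun i => dual (V i) ⊗ (X ⊗ V i)) (g := fun i => dual (V i) ⊗ (X' ⊗ V i))
      (fun i => dual (V i) ◁ (f ▷ V i)) i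
  rw [dinat_eq, dinat_eq, Preadditive.sum_comp, Preadditive.comp_sum]
  refine Finset.sum_congr rfl fun a _ => ?_
  simp only [Category.assoc, h]
  rw [← whisker_exchange_assoc, ← MonoidalCategory.whiskerLeft_comp_assoc,
    ← MonoidalCategory.whiskerLeft_comp_assoc, whisker_exchange]

/-- The endofunctor `X ↦ ⨁ i, V_i* ⊗ X ⊗ V_i`. -/
def Zfunctor (V : ι → C) : C ⥤ C where
  obj := Zobj V
  map := Zmap V
  map_id X := by
    simp only [Zmap, id_whiskerRight, MonoidalCategory.whiskerLeft_id]
    refine biproduct.hom_ext' _ _ fun j => ?_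
    simp [biproduct.ι_map, Zobj]
  map_comp f g := by
    simp only [Zmap, comp_whiskerRight, MonoidalCategory.whiskerLeft_comp]
    refine biproduct.hom_ext' _ _ fun j => ?_
    simp [biproduct.ι_map, biproduct.ι_map_assoc, Zobj]

/-- The canonical isomorphism `Y₂* ⊗ Y₁* ⊗ X ⊗ Y₁ ⊗ Y₂ ⟶ (Y₁ ⊗ Y₂)* ⊗ X ⊗ (Y₁ ⊗ Y₂)`. -/
def mulHom (X Y₁ Y₂ : C) :
    dual Y₂ ⊗ ((dual Y₁ ⊗ (X ⊗ Y₁)) ⊗ Y₂) ⟶ dual (Y₁ ⊗ Y₂) ⊗ (X ⊗ (Y₁ ⊗ Y₂)) :=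
  𝟙 _ ⊗≫ dualTensor Y₁ Y₂ ▷ (X ⊗ (Y₁ ⊗ Y₂))

/-- The canonical isomorphism `X ⟶ 𝟙* ⊗ X ⊗ 𝟙`. -/
def unitHom (X : C) : X ⟶ dual (𝟙_ C) ⊗ (X ⊗ 𝟙_ C) :=
  𝟙 _ ⊗≫ dualUnit ▷ (X ⊗ 𝟙_ C)

/-- The unit of `Z`. -/
def Zunit (hV : IsFusionFamily k V) (X : C) : X ⟶ Zobj V X :=
  unitHom X ≫ dinat hV X (𝟙_ C)

/-- The multiplication of `Z`, whose restriction to `V_j* ⊗ V_i* ⊗ X ⊗ V_i ⊗ V_j` is the canonical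
isomorphism to `(V_i ⊗ V_j)* ⊗ X ⊗ (V_i ⊗ V_j)` followed by `i_{X, V_i ⊗ V_j}`. -/
def Zmul (hV : IsFusionFamily k V) (X : C) : Zobj V (Zobj V X) ⟶ Zobj V X :=
  ∑ j, Zπ V (Zobj V X) j ≫ ∑ i, dual (V j) ◁ (Zπ V X i ▷ V j) ≫
    mulHom X (V i) (V j) ≫ dinat hV X (V i ⊗ V j)

/-- The functor `A ↦ Y* ⊗ A ⊗ Y`. -/
def conj (Y : C) : C ⥤ C := tensorRight Y ⋙ tensorLeft (dual Y)

instance (Y : C) : (conj Y).Additive := by unfold conj; infer_instance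

lemma mulHom_dinatural_left (hV : IsFusionFamily k V) (X Y₂ : C) :
    IsDinatural (conj Y₂) X (fun Y => mulHom X Y Y₂ ≫ dinat hV X (Y ⊗ Y₂)) := by
  intro Y Y' g
  change dual Y₂ ◁ ((dualMap g ▷ (X ⊗ Y)) ▷ Y₂) ≫ mulHom X Y Y₂ ≫ dinat hV X (Y ⊗ Y₂) =
    dual Y₂ ◁ ((dual Y' ◁ (X ◁ g)) ▷ Y₂) ≫ mulHom X Y' Y₂ ≫ dinat hV X (Y' ⊗ Y₂)
  have h1 : dual Y₂ ◁ ((dualMap g ▷ (X ⊗ Y)) ▷ Y₂) ≫ mulHom X Y Y₂ =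
      (𝟙 _ ⊗≫ dualTensor Y' Y₂ ▷ (X ⊗ (Y ⊗ Y₂))) ≫ dualMap (g ▷ Y₂) ▷ (X ⊗ (Y ⊗ Y₂)) := by
    calc _ = 𝟙 _ ⊗≫ (dual Y₂ ◁ dualMap g ≫ dualTensor Y Y₂) ▷ (X ⊗ (Y ⊗ Y₂)) := by
          simp only [mulHom]; monoidal
      _ = _ := by rw [dualTensor_nat_left]; monoidal
  have h2 : dual Y₂ ◁ ((dual Y' ◁ (X ◁ g)) ▷ Y₂) ≫ mulHom X Y' Y₂ =
      (𝟙 _ ⊗≫ dualTensor Y' Y₂ ▷ (X ⊗ (Y ⊗ Y₂))) ≫ dual (Y' ⊗ Y₂) ◁ (X ◁ (g ▷ Y₂)) := by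
    calc _ = 𝟙 _ ⊗≫ ((dual Y₂ ⊗ dual Y') ◁ (X ◁ (g ▷ Y₂)) ≫
          dualTensor Y' Y₂ ▷ (X ⊗ (Y' ⊗ Y₂))) := by simp only [mulHom]; monoidal
      _ = _ := by rw [whisker_exchange]; monoidal
  rw [← Category.assoc, h1, Category.assoc, dinat_dinatural, ← Category.assoc, ← h2, Category.assoc]

lemma mulHom_nat {X X' : C} (f : X ⟶ X') (Y₁ Y₂ : C) :
    dual Y₂ ◁ ((dual Y₁ ◁ (f ▷ Y₁)) ▷ Y₂) ≫ mulHom X' Y₁ Y₂ =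
      mulHom X Y₁ Y₂ ≫ dual (Y₁ ⊗ Y₂) ◁ (f ▷ (Y₁ ⊗ Y₂)) := by
  calc _ = 𝟙 _ ⊗≫ ((dual Y₂ ⊗ dual Y₁) ◁ (f ▷ (Y₁ ⊗ Y₂)) ≫
          dualTensor Y₁ Y₂ ▷ (X' ⊗ (Y₁ ⊗ Y₂))) := by simp only [mulHom]; monoidal
    _ = _ := by rw [whisker_exchange]; simp only [mulHom]; monoidal

lemma Zmul_aux (hV : IsFusionFamily k V) (X : C) (Y : C) :
    dinat hV (Zobj V X) Y ≫ Zmul hV X = ∑ i, dual Y ◁ (Zπ V X i ▷ Y) ≫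
      mulHom X (V i) Y ≫ dinat hV X (V i ⊗ Y) := by
  refine dinat_desc hV (𝟭 C) (Zobj V X) (fun Y => ∑ i, dual Y ◁ (Zπ V X i ▷ Y) ≫
      mulHom X (V i) Y ≫ dinat hV X (V i ⊗ Y)) ?_ Y
  intro Y Y' g
  change dualMap g ▷ (Zobj V X ⊗ Y) ≫ (∑ i, dual Y ◁ (Zπ V X i ▷ Y) ≫
      mulHom X (V i) Y ≫ dinat hV X (V i ⊗ Y)) = dual Y' ◁ (Zobj V X ◁ g) ≫
      (∑ i, dual Y' ◁ (Zπ V X i ▷ Y') ≫ mulHom X (V i) Y' ≫ dinat hV X (V i ⊗ Y'))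
  rw [Preadditive.comp_sum, Preadditive.comp_sum]
  refine Finset.sum_congr rfl fun i _ => ?_
  have h1 : dualMap g ▷ (Zobj V X ⊗ Y) ≫ dual Y ◁ (Zπ V X i ▷ Y) ≫ mulHom X (V i) Y =
      (dual Y' ◁ (Zπ V X i ▷ Y) ⊗≫ dualTensor (V i) Y' ▷ (X ⊗ (V i ⊗ Y))) ≫
        dualMap (V i ◁ g) ▷ (X ⊗ (V i ⊗ Y)) := by
    rw [← whisker_exchange_assoc]
    calc _ = dual Y' ◁ (Zπ V X i ▷ Y) ⊗≫
          (dualMap g ▷ dual (V i) ≫ dualTensor (V i) Y) ▷ (X ⊗ (V i ⊗ Y)) := by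
          simp only [mulHom]; monoidal
      _ = _ := by rw [dualTensor_nat_right]; monoidal
  have h2 : dual Y' ◁ (Zobj V X ◁ g) ≫ dual Y' ◁ (Zπ V X i ▷ Y') ≫ mulHom X (V i) Y' =
      (dual Y' ◁ (Zπ V X i ▷ Y) ⊗≫ dualTensor (V i) Y' ▷ (X ⊗ (V i ⊗ Y))) ≫
        dual (V i ⊗ Y') ◁ (X ◁ (V i ◁ g)) := by
    rw [← MonoidalCategory.whiskerLeft_comp_assoc, whisker_exchange]
    calc _ = dual Y' ◁ (Zπ V X i ▷ Y) ⊗≫ ((dual Y' ⊗ dual (V i)) ◁ (X ◁ (V i ◁ g)) ≫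
          dualTensor (V i) Y' ▷ (X ⊗ (V i ⊗ Y'))) := by simp only [mulHom]; monoidal
      _ = _ := by rw [whisker_exchange]; monoidal
  have h1' := congrArg (· ≫ dinat hV X (V i ⊗ Y)) h1
  have h2' := congrArg (· ≫ dinat hV X (V i ⊗ Y')) h2
  simp only [Category.assoc] at h1' h2'
  rw [h1', h2', dinat_dinatural]

/-- The multiplication is characterized by the dinatural transformation. -/
lemma dinat_Zmul (hV : IsFusionFamily k V) (X Y₁ Y₂ : C) :
    dual Y₂ ◁ (dinat hV X Y₁ ▷ Y₂) ≫ dinat hV (Zobj V X) Y₂ ≫ Zmul hV X =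
      mulHom X Y₁ Y₂ ≫ dinat hV X (Y₁ ⊗ Y₂) := by
  rw [Zmul_aux]
  exact dinat_desc hV (conj Y₂) X _ (mulHom_dinatural_left hV X Y₂) Y₁

lemma mulHom_assoc (hV : IsFusionFamily k V) (X Y₁ Y₂ Y₃ : C) :
    dual Y₃ ◁ (mulHom X Y₁ Y₂ ▷ Y₃) ≫ mulHom X (Y₁ ⊗ Y₂) Y₃ ≫ dinat hV X ((Y₁ ⊗ Y₂) ⊗ Y₃) =
      mulHom (dual Y₁ ⊗ (X ⊗ Y₁)) Y₂ Y₃ ≫ mulHom X Y₁ (Y₂ ⊗ Y₃) ≫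
        dinat hV X (Y₁ ⊗ (Y₂ ⊗ Y₃)) := by
  have h1 : dual Y₃ ◁ (mulHom X Y₁ Y₂ ▷ Y₃) ≫ mulHom X (Y₁ ⊗ Y₂) Y₃ =
      (𝟙 _ ⊗≫ (dualTensor Y₂ Y₃ ▷ dual Y₁ ≫ dualTensor Y₁ (Y₂ ⊗ Y₃)) ▷ (X ⊗ ((Y₁ ⊗ Y₂) ⊗ Y₃))) ≫
        dualMap (α_ Y₁ Y₂ Y₃).hom ▷ (X ⊗ ((Y₁ ⊗ Y₂) ⊗ Y₃)) := by
    calc _ = 𝟙 _ ⊗≫ (dual Y₃ ◁ dualTensor Y₁ Y₂ ≫ dualTensor (Y₁ ⊗ Y₂) Y₃) ▷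
          (X ⊗ ((Y₁ ⊗ Y₂) ⊗ Y₃)) := by simp only [mulHom]; monoidal
      _ = _ := by rw [dualTensor_assoc]; monoidal
  have h2 : mulHom (dual Y₁ ⊗ (X ⊗ Y₁)) Y₂ Y₃ ≫ mulHom X Y₁ (Y₂ ⊗ Y₃) =
      (𝟙 _ ⊗≫ (dualTensor Y₂ Y₃ ▷ dual Y₁ ≫ dualTensor Y₁ (Y₂ ⊗ Y₃)) ▷ (X ⊗ ((Y₁ ⊗ Y₂) ⊗ Y₃))) ≫
        dual (Y₁ ⊗ (Y₂ ⊗ Y₃)) ◁ (X ◁ (α_ Y₁ Y₂ Y₃).hom) := by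
    simp only [mulHom]; monoidal
  have h1' := congrArg (· ≫ dinat hV X ((Y₁ ⊗ Y₂) ⊗ Y₃)) h1
  have h2' := congrArg (· ≫ dinat hV X (Y₁ ⊗ (Y₂ ⊗ Y₃))) h2
  simp only [Category.assoc] at h1' h2'
  rw [h1', h2', dinat_dinatural]

lemma unitHom_nat {X X' : C} (f : X ⟶ X') :
    f ≫ unitHom X' = unitHom X ≫ dual (𝟙_ C) ◁ (f ▷ 𝟙_ C) := by
  calc _ = 𝟙 _ ⊗≫ (𝟙_ C ◁ (f ▷ 𝟙_ C) ≫ dualUnit ▷ (X' ⊗ 𝟙_ C)) := by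
        simp only [unitHom]; monoidal
    _ = _ := by rw [whisker_exchange]; simp only [unitHom]; monoidal

lemma mulHom_unit_right (hV : IsFusionFamily k V) (X Y : C) :
    unitHom (dual Y ⊗ (X ⊗ Y)) ≫ mulHom X Y (𝟙_ C) ≫ dinat hV X (Y ⊗ 𝟙_ C) = dinat hV X Y := by
  have h1 : unitHom (dual Y ⊗ (X ⊗ Y)) ≫ mulHom X Y (𝟙_ C) =
      dual Y ◁ (X ◁ (ρ_ Y).inv) ≫ dualMap (ρ_ Y).hom ▷ (X ⊗ (Y ⊗ 𝟙_ C)) := by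
    rw [← dualTensor_unit_right]
    simp only [mulHom, unitHom]
    monoidal
  have h1' := congrArg (· ≫ dinat hV X (Y ⊗ 𝟙_ C)) h1
  simp only [Category.assoc] at h1'
  rw [h1', dinat_dinatural]
  rw [← MonoidalCategory.whiskerLeft_comp_assoc, ← MonoidalCategory.whiskerLeft_comp,
    Iso.inv_hom_id, MonoidalCategory.whiskerLeft_id, MonoidalCategory.whiskerLeft_id,
    Category.id_comp]

lemma mulHom_unit_left (hV : IsFusionFamily k V) (X Y : C) :
    dual Y ◁ (unitHom X ▷ Y) ≫ mulHom X (𝟙_ C) Y ≫ dinat hV X (𝟙_ C ⊗ Y) = dinat hV X Y := by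
  have h1 : dual Y ◁ (unitHom X ▷ Y) ≫ mulHom X (𝟙_ C) Y =
      dual Y ◁ (X ◁ (λ_ Y).inv) ≫ dualMap (λ_ Y).hom ▷ (X ⊗ (𝟙_ C ⊗ Y)) := by
    rw [← dualTensor_unit_left]
    simp only [mulHom, unitHom]
    monoidal
  have h1' := congrArg (· ≫ dinat hV X (𝟙_ C ⊗ Y)) h1
  simp only [Category.assoc] at h1'
  rw [h1', dinat_dinatural]
  rw [← MonoidalCategory.whiskerLeft_comp_assoc, ← MonoidalCategory.whiskerLeft_comp,
    Iso.inv_hom_id, MonoidalCategory.whiskerLeft_id, MonoidalCategory.whiskerLeft_id,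
    Category.id_comp]

/-- The monad `Z` on a fusion category: the centralizer of the identity, given on objects by the
coend `∫^Y Y* ⊗ X ⊗ Y = ⨁ i, V_i* ⊗ X ⊗ V_i` with universal dinatural transformation `dinat`. -/
def Zmonad (hV : IsFusionFamily k V) : Monad C where
  toFunctor := Zfunctor V
  η :=
    { app := Zunit hV
      naturality := fun X X' f => by
        change f ≫ Zunit hV X' = Zunit hV X ≫ Zmap V f
        rw [Zunit, Zunit, Category.assoc, dinat_naturality, ← Category.assoc, unitHom_nat,
          Category.assoc] }
  μ :=
    { app := Zmul hV
      naturality := fun X X' f => by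
        change Zmap V (Zmap V f) ≫ Zmul hV X' = Zmul hV X ≫ Zmap V f
        refine dinat_hom_ext hV (𝟭 C) _ fun Y₂ => ?_
        refine dinat_hom_ext hV (conj Y₂) X fun Y₁ => ?_
        change dual Y₂ ◁ (dinat hV X Y₁ ▷ Y₂) ≫ dinat hV (Zobj V X) Y₂ ≫
            Zmap V (Zmap V f) ≫ Zmul hV X' =
          dual Y₂ ◁ (dinat hV X Y₁ ▷ Y₂) ≫ dinat hV (Zobj V X) Y₂ ≫ Zmul hV X ≫ Zmap V f
        have hR := congrArg (· ≫ Zmap V f) (dinat_Zmul hV X Y₁ Y₂)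
        simp only [Category.assoc] at hR
        rw [hR, dinat_naturality, ← Category.assoc (dinat hV (Zobj V X) Y₂), dinat_naturality,
          Category.assoc, ← MonoidalCategory.whiskerLeft_comp_assoc, ← comp_whiskerRight,
          dinat_naturality, comp_whiskerRight, MonoidalCategory.whiskerLeft_comp, Category.assoc,
          dinat_Zmul, ← Category.assoc, mulHom_nat, Category.assoc] }
  assoc X := by
    change Zmap V (Zmul hV X) ≫ Zmul hV X = Zmul hV (Zobj V X) ≫ Zmul hV X
    refine dinat_hom_ext hV (𝟭 C) _ fun Y₃ => ?_
    refine dinat_hom_ext hV (conj Y₃) _ fun Y₂ => ?_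
    refine dinat_hom_ext hV (conj Y₂ ⋙ conj Y₃) X fun Y₁ => ?_
    change dual Y₃ ◁ ((dual Y₂ ◁ (dinat hV X Y₁ ▷ Y₂)) ▷ Y₃) ≫
        dual Y₃ ◁ (dinat hV (Zobj V X) Y₂ ▷ Y₃) ≫ dinat hV (Zobj V (Zobj V X)) Y₃ ≫
          Zmap V (Zmul hV X) ≫ Zmul hV X =
      dual Y₃ ◁ ((dual Y₂ ◁ (dinat hV X Y₁ ▷ Y₂)) ▷ Y₃) ≫
        dual Y₃ ◁ (dinat hV (Zobj V X) Y₂ ▷ Y₃) ≫ dinat hV (Zobj V (Zobj V X)) Y₃ ≫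
          Zmul hV (Zobj V X) ≫ Zmul hV X
    have hL : dual Y₃ ◁ ((dual Y₂ ◁ (dinat hV X Y₁ ▷ Y₂)) ▷ Y₃) ≫
        dual Y₃ ◁ (dinat hV (Zobj V X) Y₂ ▷ Y₃) ≫ dinat hV (Zobj V (Zobj V X)) Y₃ ≫
          Zmap V (Zmul hV X) ≫ Zmul hV X =
        dual Y₃ ◁ (mulHom X Y₁ Y₂ ▷ Y₃) ≫ mulHom X (Y₁ ⊗ Y₂) Y₃ ≫
          dinat hV X ((Y₁ ⊗ Y₂) ⊗ Y₃) := by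
      rw [← Category.assoc (dinat hV (Zobj V (Zobj V X)) Y₃), dinat_naturality, Category.assoc,
        ← MonoidalCategory.whiskerLeft_comp_assoc, ← MonoidalCategory.whiskerLeft_comp_assoc,
        ← comp_whiskerRight, ← comp_whiskerRight,
        Category.assoc (dual Y₂ ◁ (dinat hV X Y₁ ▷ Y₂)), dinat_Zmul, comp_whiskerRight,
        MonoidalCategory.whiskerLeft_comp, Category.assoc, dinat_Zmul]
    have hR : dual Y₃ ◁ ((dual Y₂ ◁ (dinat hV X Y₁ ▷ Y₂)) ▷ Y₃) ≫
        dual Y₃ ◁ (dinat hV (Zobj V X) Y₂ ▷ Y₃) ≫ dinat hV (Zobj V (Zobj V X)) Y₃ ≫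
          Zmul hV (Zobj V X) ≫ Zmul hV X =
        mulHom (dual Y₁ ⊗ (X ⊗ Y₁)) Y₂ Y₃ ≫ mulHom X Y₁ (Y₂ ⊗ Y₃) ≫
          dinat hV X (Y₁ ⊗ (Y₂ ⊗ Y₃)) := by
      have h := congrArg (· ≫ Zmul hV X) (dinat_Zmul hV (Zobj V X) Y₂ Y₃)
      simp only [Category.assoc] at h
      rw [h, ← Category.assoc, mulHom_nat, Category.assoc, dinat_Zmul]
    rw [hL, hR, mulHom_assoc]
  left_unit X := by
    change Zunit hV (Zobj V X) ≫ Zmul hV X = 𝟙 (Zobj V X)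
    refine dinat_hom_ext hV (𝟭 C) _ fun Y => ?_
    change dinat hV X Y ≫ Zunit hV (Zobj V X) ≫ Zmul hV X = dinat hV X Y ≫ 𝟙 (Zobj V X)
    rw [Zunit, Category.assoc, ← Category.assoc, unitHom_nat, Category.assoc, dinat_Zmul,
      mulHom_unit_right, Category.comp_id]
  right_unit X := by
    change Zmap V (Zunit hV X) ≫ Zmul hV X = 𝟙 (Zobj V X)
    refine dinat_hom_ext hV (𝟭 C) _ fun Y => ?_
    change dinat hV X Y ≫ Zmap V (Zunit hV X) ≫ Zmul hV X = dinat hV X Y ≫ 𝟙 (Zobj V X)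
    rw [← Category.assoc, dinat_naturality, Category.assoc, Zunit, comp_whiskerRight,
      MonoidalCategory.whiskerLeft_comp, Category.assoc, dinat_Zmul, mulHom_unit_left,
      Category.comp_id]

end Centralizer

/-- A monad is semisimple if each of its modules is a retract, as a module, of a free module. -/
def IsSemisimpleMonad {C : Type u} [Category.{v} C] (T : Monad C) : Prop :=
  ∀ M : T.Algebra, ∃ X : C, Nonempty (Retract M (T.free.obj X))

end SphericalFusion

end

noncomputable section

namespace SphericalFusion

/-! ### Duality calculus in a rigid category. -/

section RigidLemmas

variable {C : Type u} [Category.{v} C] [MonoidalCategory C] [RightRigidCategory C]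

/-! This is a Maschke theorem for `Z`. A `Z`-module is an object M with a half braiding M ⊗ W ⟶ W ⊗
M. The averaging map M ⟶ Z(M) creates, for every i, a pair V_i*, V_i, moves V_i across M, and
weights the result by d_i = dim_r(V_i). Followed by the action, each pair closes up to a loop of
value dim_l(V_i), so the composite is dim C times the identity (`average_Zact`). The averaging map
is Z-linear (`Zmap_average`); if dim C is invertible, rescaling it splits M off Z(M).

Linearity is the heart of the matter. On the component Y, projected to the summand j, both sides
move M to the right of Y, apply some Y* ⊗ Y ⟶ V_j* ⊗ V_j, and move M back. Hence M drops out, and by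
duality it remains to compare two endomorphisms of V_j ⊗ Y*: the operator `averaging` with weights
d, and d_j • 𝟙. Precompose with g : V_l ⟶ V_j ⊗ Y* (`comp_averaging`). Only the terms with i = l
survive. For an inclusion q of V_j into V_l ⊗ Y, the two ways of composing g with q are scalars x on
V_l and y on V_j, and cyclicity of the trace gives x d_l = y d_j (`rightTrace_comp_flatt`). So d_l
is traded for d_j without any division, and the remaining sum of inclusions and projections restores
g.

Conversely, 𝟙 is a `Z`-module. If it is a retract of a free module, its action Z(𝟙) ⟶ 𝟙 has a
Z-linear section Λ. Since Hom(𝟙, V_i* ⊗ V_i) ≅ End(V_i) = k, Λ is given by scalars c_i. Linearity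
says that `averaging` with weights c is c_j • 𝟙; testing this on the coevaluation of V_j, regarded
as a map out of the member of the family isomorphic to 𝟙, gives c_j = t d_j with t independent of j
(`coord_eq_of_linear`). The equation expressing that Λ is a section then reads t · dim C = 1. -/

lemma coev_ev (X : C) : coev X ▷ X ⊗≫ X ◁ ev X = ⊗𝟙.hom :=
  ExactPairing.evaluation_coevaluation'' X Xᘁ

lemma dual_coev_ev (X : C) : dual X ◁ coev X ⊗≫ ev X ▷ dual X = ⊗𝟙.hom :=
  ExactPairing.coevaluation_evaluation'' X Xᘁ

lemma coev_dinatural {X Y : C} (f : X ⟶ Y) :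
    coev X ≫ f ▷ dual X = coev Y ≫ Y ◁ dualMap f :=
  (coevaluation_comp_rightAdjointMate f).symm

/-- The coevaluation is determined by one triangle identity. -/
lemma eq_coev {X : C} (N : 𝟙_ C ⟶ X ⊗ dual X) (h : N ▷ X ⊗≫ X ◁ ev X = ⊗𝟙.hom) :
    N = coev X := by
  -- Uniqueness of the unit of an adjunction: insert the other triangle identity on the dual strand,
  -- then slide `N` past the new `coev X` so that `h` applies.
  calc N = N ⊗≫ X ◁ (⊗𝟙.hom : dual X ⊗ 𝟙_ C ⟶ 𝟙_ C ⊗ dual X) ⊗≫ 𝟙 _ := by monoidal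
    _ = 𝟙 _ ⊗≫ (N ▷ 𝟙_ C ≫ (X ⊗ dual X) ◁ coev X) ⊗≫ X ◁ ev X ▷ dual X ⊗≫ 𝟙 _ := by
      rw [← dual_coev_ev]; monoidal
    _ = coev X ⊗≫ (N ▷ X ⊗≫ X ◁ ev X) ▷ dual X ⊗≫ 𝟙 _ := by
      rw [← whisker_exchange]; monoidal
    _ = coev X := by rw [h]; monoidal

/-- Nested coevaluations satisfy the triangle identity against the nested evaluation, which
determines the coevaluation by `eq_coev`. -/
lemma coev_tensor (X Y : C) :
    coev (X ⊗ Y) = coev X ⊗≫ X ◁ coev Y ▷ dual X ⊗≫ (X ⊗ Y) ◁ dualTensor X Y := by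
  symm
  apply eq_coev
  calc _ = coev X ▷ (X ⊗ Y) ⊗≫ X ◁ coev Y ▷ (dual X ⊗ X ⊗ Y) ⊗≫
        (X ⊗ Y) ◁ (dualTensor X Y ▷ (X ⊗ Y) ≫ ev (X ⊗ Y)) := by monoidal
    _ = coev X ▷ (X ⊗ Y) ⊗≫ X ◁ (coev Y ▷ (dual X ⊗ X) ≫ (Y ⊗ dual Y) ◁ ev X) ▷ Y ⊗≫
        (X ⊗ Y) ◁ ev Y := by rw [dualTensor_ev, evNested]; monoidal
    _ = 𝟙 _ ⊗≫ (coev X ▷ X ⊗≫ X ◁ ev X) ▷ Y ⊗≫ X ◁ (coev Y ▷ Y ⊗≫ Y ◁ ev Y) ⊗≫ 𝟙 _ := by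
      rw [← whisker_exchange]; monoidal
    _ = _ := by rw [coev_ev, coev_ev]; monoidal

lemma coev_unit : coev (𝟙_ C) = (λ_ (𝟙_ C)).inv ≫ 𝟙_ C ◁ dualUnit := by
  symm
  apply eq_coev
  calc _ = 𝟙 _ ⊗≫ 𝟙_ C ◁ (dualUnit ▷ 𝟙_ C ≫ ev (𝟙_ C)) ⊗≫ 𝟙 _ := by monoidal
    _ = _ := by rw [dualUnit_ev]; monoidal

/-- The morphism `A ⊗ Y ⟶ B` that corresponds to `A ⟶ B ⊗ Y*`. -/
def flat {A B Y : C} (g : A ⟶ B ⊗ dual Y) : A ⊗ Y ⟶ B := g ▷ Y ⊗≫ B ◁ ev Y ⊗≫ 𝟙 _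

/-- The morphism `A ⟶ B ⊗ Y*` that corresponds to `A ⊗ Y ⟶ B`. -/
def sharp {A B Y : C} (p : A ⊗ Y ⟶ B) : A ⟶ B ⊗ dual Y := 𝟙 _ ⊗≫ A ◁ coev Y ⊗≫ p ▷ dual Y

lemma flat_sharp {A B Y : C} (p : A ⊗ Y ⟶ B) : flat (sharp p) = p := by
  calc flat (sharp p) = 𝟙 _ ⊗≫ A ◁ coev Y ▷ Y ⊗≫ (p ▷ (dual Y ⊗ Y) ≫ B ◁ ev Y) ⊗≫ 𝟙 _ := by
        simp only [flat, sharp]; monoidal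
    _ = 𝟙 _ ⊗≫ A ◁ (coev Y ▷ Y ⊗≫ Y ◁ ev Y) ⊗≫ p := by rw [← whisker_exchange]; monoidal
    _ = _ := by rw [coev_ev]; monoidal

lemma sharp_flat {A B Y : C} (g : A ⟶ B ⊗ dual Y) : sharp (flat g) = g := by
  calc sharp (flat g) = 𝟙 _ ⊗≫ (A ◁ coev Y ≫ g ▷ (Y ⊗ dual Y)) ⊗≫ B ◁ ev Y ▷ dual Y ⊗≫ 𝟙 _ := by
        simp only [flat, sharp]; monoidal
    _ = g ⊗≫ B ◁ (dual Y ◁ coev Y ⊗≫ ev Y ▷ dual Y) ⊗≫ 𝟙 _ := by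
        rw [whisker_exchange]; monoidal
    _ = _ := by rw [dual_coev_ev]; monoidal

end RigidLemmas

/-! ### The second duality of a sovereign category, traces and transposition. -/

namespace SovereignStructure

section SovereignLemmas

variable {C : Type u} [Category.{v} C] [MonoidalCategory C] [RightRigidCategory C]
  (S : SovereignStructure C)

/-- The evaluation `X ⊗ X* ⟶ 𝟙` of the other duality. -/
def evt (X : C) : X ⊗ dual X ⟶ 𝟙_ C := (S.φ X).hom ▷ dual X ≫ ev (dual X)

/-- The coevaluation `𝟙 ⟶ X* ⊗ X` of the other duality. -/
def coevt (X : C) : 𝟙_ C ⟶ dual X ⊗ X := coev (dual X) ≫ dual X ◁ (S.φ X).inv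

lemma leftTrace_eq {X : C} (f : X ⟶ X) : S.leftTrace f = S.coevt X ≫ dual X ◁ f ≫ ev X := by
  simp [leftTrace, coevt]

lemma rightTrace_eq {X : C} (f : X ⟶ X) : S.rightTrace f = coev X ≫ f ▷ dual X ≫ S.evt X := by
  simp [rightTrace, evt]

lemma coevt_evt (X : C) : X ◁ S.coevt X ⊗≫ S.evt X ▷ X = ⊗𝟙.hom := by
  calc _ = 𝟙 _ ⊗≫ (X ◁ coev (dual X) ≫ (S.φ X).hom ▷ (dual X ⊗ dual (dual X))) ⊗≫
          (((dual (dual X) ⊗ dual X) ◁ (S.φ X).inv) ≫ ev (dual X) ▷ X) ⊗≫ 𝟙 _ := by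
        have h := whisker_exchange (S.φ X).hom (dual X ◁ (S.φ X).inv)
        calc _ = X ◁ coev (dual X) ⊗≫ (X ◁ dual X ◁ (S.φ X).inv ≫ (S.φ X).hom ▷ (dual X ⊗ X))
              ⊗≫ ev (dual X) ▷ X := by simp only [evt, coevt]; monoidal
          _ = _ := by rw [h]; monoidal
    _ = 𝟙 _ ⊗≫ (S.φ X).hom ⊗≫ (dual (dual X) ◁ coev (dual X) ⊗≫ ev (dual X) ▷ dual (dual X))
          ⊗≫ (S.φ X).inv ⊗≫ 𝟙 _ := by
        rw [whisker_exchange, whisker_exchange]; monoidal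
    _ = 𝟙 _ ⊗≫ ((S.φ X).hom ≫ (S.φ X).inv) ⊗≫ 𝟙 _ := by rw [dual_coev_ev]; monoidal
    _ = _ := by rw [Iso.hom_inv_id]; monoidal

lemma dual_coevt_evt (X : C) : S.coevt X ▷ dual X ⊗≫ dual X ◁ S.evt X = ⊗𝟙.hom := by
  calc _ = coev (dual X) ▷ dual X ⊗≫ dual X ◁ ((S.φ X).inv ≫ (S.φ X).hom) ▷ dual X ⊗≫
        dual X ◁ ev (dual X) := by simp only [evt, coevt]; monoidal
    _ = coev (dual X) ▷ dual X ⊗≫ dual X ◁ ev (dual X) := by rw [Iso.inv_hom_id]; monoidal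
    _ = _ := coev_ev _

lemma evt_dinatural {X Y : C} (f : X ⟶ Y) :
    f ▷ dual Y ≫ S.evt Y = X ◁ dualMap f ≫ S.evt X := by
  rw [evt, evt, ← comp_whiskerRight_assoc, S.naturality, comp_whiskerRight_assoc, dualMap_ev,
    whisker_exchange_assoc]

/-- The other coevaluation is determined by one triangle identity. -/
lemma eq_coevt {X : C} (N : 𝟙_ C ⟶ dual X ⊗ X) (h : X ◁ N ⊗≫ S.evt X ▷ X = ⊗𝟙.hom) :
    N = S.coevt X := by
  calc N = N ⊗≫ (⊗𝟙.hom : 𝟙_ C ⊗ dual X ⟶ dual X ⊗ 𝟙_ C) ▷ X ⊗≫ 𝟙 _ := by monoidal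
    _ = 𝟙 _ ⊗≫ (𝟙_ C ◁ N ≫ S.coevt X ▷ (dual X ⊗ X)) ⊗≫ dual X ◁ S.evt X ▷ X ⊗≫ 𝟙 _ := by
      rw [← S.dual_coevt_evt]; monoidal
    _ = S.coevt X ⊗≫ dual X ◁ (X ◁ N ⊗≫ S.evt X ▷ X) ⊗≫ 𝟙 _ := by
      rw [whisker_exchange]; monoidal
    _ = S.coevt X := by rw [h]; monoidal

lemma coevt_dinatural {X Y : C} (f : X ⟶ Y) :
    S.coevt X ≫ dual X ◁ f = S.coevt Y ≫ dualMap f ▷ Y := by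
  have h : X ◁ (S.coevt Y ≫ dualMap f ▷ Y) ⊗≫ S.evt X ▷ Y = ⊗𝟙.hom ≫ f ⊗≫ 𝟙 _ := by
    calc _ = X ◁ S.coevt Y ⊗≫ (X ◁ dualMap f ≫ S.evt X) ▷ Y := by monoidal
      _ = 𝟙 _ ⊗≫ (X ◁ S.coevt Y ≫ f ▷ (dual Y ⊗ Y)) ⊗≫ S.evt Y ▷ Y := by
        rw [← evt_dinatural]; monoidal
      _ = 𝟙 _ ⊗≫ f ⊗≫ (Y ◁ S.coevt Y ⊗≫ S.evt Y ▷ Y) := by rw [whisker_exchange]; monoidal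
      _ = _ := by rw [coevt_evt]; monoidal
  symm
  calc S.coevt Y ≫ dualMap f ▷ Y
      = (S.coevt Y ≫ dualMap f ▷ Y) ⊗≫ (⊗𝟙.hom : 𝟙_ C ⊗ dual X ⟶ dual X ⊗ 𝟙_ C) ▷ Y ⊗≫ 𝟙 _ := by
        monoidal
    _ = 𝟙 _ ⊗≫ (𝟙_ C ◁ (S.coevt Y ≫ dualMap f ▷ Y) ≫ S.coevt X ▷ (dual X ⊗ Y)) ⊗≫
          dual X ◁ S.evt X ▷ Y ⊗≫ 𝟙 _ := by
      rw [← S.dual_coevt_evt]; monoidal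
    _ = S.coevt X ⊗≫ dual X ◁ (X ◁ (S.coevt Y ≫ dualMap f ▷ Y) ⊗≫ S.evt X ▷ Y) ⊗≫ 𝟙 _ := by
      rw [whisker_exchange]; monoidal
    _ = _ := by rw [h]; monoidal

/-- Monoidality of `φ` is what makes the evaluations of the second duality nest. -/
lemma evt_tensor (X Y : C) :
    (X ⊗ Y) ◁ dualTensor X Y ≫ S.evt (X ⊗ Y) =
      𝟙 _ ⊗≫ X ◁ S.evt Y ▷ dual X ⊗≫ S.evt X := by
  calc _ = ((S.φ (X ⊗ Y)).hom ≫ dualMap (dualTensor X Y)) ▷ (dual Y ⊗ dual X) ≫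
        ev (dual Y ⊗ dual X) := by
        rw [evt, whisker_exchange_assoc, ← dualMap_ev, comp_whiskerRight_assoc]
    _ = ((S.φ X).hom ⊗ₘ (S.φ Y).hom) ▷ (dual Y ⊗ dual X) ≫
        evNested (dual Y) (dual X) := by
        rw [S.tensor, comp_whiskerRight_assoc, dualTensor_ev]
    _ = 𝟙 _ ⊗≫ X ◁ ((S.φ Y).hom ▷ dual Y) ▷ dual X ⊗≫ ((S.φ X).hom ▷ ((dual (dual Y) ⊗ dual Y) ⊗
          dual X) ≫ dual (dual X) ◁ (ev (dual Y) ▷ dual X)) ⊗≫ ev (dual X) := by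
        rw [tensorHom_def']; simp only [evNested]; monoidal
    _ = _ := by rw [← whisker_exchange]; simp only [evt]; monoidal

lemma coevt_tensor (X Y : C) :
    S.coevt (X ⊗ Y) =
      S.coevt Y ⊗≫ dual Y ◁ S.coevt X ▷ Y ⊗≫ dualTensor X Y ▷ (X ⊗ Y) := by
  symm
  apply eq_coevt
  calc _ = (X ⊗ Y) ◁ S.coevt Y ⊗≫ (X ⊗ Y) ◁ (dual Y ◁ S.coevt X ▷ Y) ⊗≫
        ((X ⊗ Y) ◁ dualTensor X Y ≫ S.evt (X ⊗ Y)) ▷ (X ⊗ Y) := by monoidal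
    _ = (X ⊗ Y) ◁ S.coevt Y ⊗≫ X ◁ ((Y ⊗ dual Y) ◁ S.coevt X ≫ S.evt Y ▷ (dual X ⊗ X)) ▷ Y ⊗≫
        S.evt X ▷ (X ⊗ Y) := by rw [evt_tensor]; monoidal
    _ = 𝟙 _ ⊗≫ X ◁ (Y ◁ S.coevt Y ⊗≫ S.evt Y ▷ Y) ⊗≫ (X ◁ S.coevt X ⊗≫ S.evt X ▷ X) ▷ Y ⊗≫
        𝟙 _ := by rw [whisker_exchange]; monoidal
    _ = _ := by rw [coevt_evt, coevt_evt]; monoidal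

/-- The morphism `B ⊗ Y* ⟶ A` that corresponds to `B ⟶ A ⊗ Y`. -/
def flatt {A B Y : C} (q : B ⟶ A ⊗ Y) : B ⊗ dual Y ⟶ A := q ▷ dual Y ⊗≫ A ◁ S.evt Y ⊗≫ 𝟙 _

/-- Both sides are the same closed diagram in `g` and `q`, with the strand `Y` bent differently: `q`
is carried once around the loop by dinaturality of `coev` and `evt`. For simple `A` and `B` this
relates two scalars through the dimensions of `A` and `B`. -/
lemma rightTrace_comp_flatt {A B Y : C} (g : A ⟶ B ⊗ dual Y) (q : B ⟶ A ⊗ Y) :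
    S.rightTrace (g ≫ S.flatt q) = S.rightTrace (q ≫ flat g) := by
  have h : coev (A ⊗ Y) ≫ flat g ▷ dual (A ⊗ Y) =
      coev A ≫ g ▷ dual A ⊗≫ B ◁ dualTensor A Y := by
    -- The arc `coev Y` meets the `ev Y` inside `flat g`, and the zigzag straightens.
    calc _ = coev A ⊗≫ A ◁ coev Y ▷ dual A ⊗≫
          ((A ⊗ Y) ◁ dualTensor A Y ≫ flat g ▷ dual (A ⊗ Y)) := by rw [coev_tensor]; monoidal
      _ = coev A ⊗≫ (A ◁ coev Y ≫ g ▷ (Y ⊗ dual Y)) ▷ dual A ⊗≫ B ◁ ev Y ▷ (dual Y ⊗ dual A) ⊗≫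
          B ◁ dualTensor A Y := by rw [whisker_exchange]; simp only [flat]; monoidal
      _ = coev A ⊗≫ g ▷ dual A ⊗≫ B ◁ (dual Y ◁ coev Y ⊗≫ ev Y ▷ dual Y) ▷ dual A ⊗≫
          B ◁ dualTensor A Y := by rw [whisker_exchange]; monoidal
      _ = _ := by rw [dual_coev_ev]; monoidal
  have h2 : coev B ≫ (q ≫ flat g) ▷ dual B = coev A ≫ g ▷ dual A ⊗≫ B ◁ dualTensor A Y ≫
      B ◁ dualMap q := by
    calc _ = (coev (A ⊗ Y) ≫ (A ⊗ Y) ◁ dualMap q) ≫ flat g ▷ dual B := by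
          rw [← coev_dinatural]; simp
      _ = (coev (A ⊗ Y) ≫ flat g ▷ dual (A ⊗ Y)) ≫ B ◁ dualMap q := by
          rw [Category.assoc, whisker_exchange, Category.assoc]
      _ = _ := by rw [h]; monoidal
  calc _ = coev A ≫ g ▷ dual A ⊗≫ q ▷ (dual Y ⊗ dual A) ⊗≫
        (𝟙 ((A ⊗ Y) ⊗ (dual Y ⊗ dual A)) ⊗≫ A ◁ S.evt Y ▷ dual A ⊗≫ S.evt A) := by
        rw [rightTrace_eq]; simp only [flatt]; monoidal
    _ = coev A ≫ g ▷ dual A ⊗≫ (q ▷ (dual Y ⊗ dual A) ≫ (A ⊗ Y) ◁ dualTensor A Y) ≫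
        S.evt (A ⊗ Y) := by rw [← evt_tensor]; monoidal
    _ = coev A ≫ g ▷ dual A ⊗≫ B ◁ dualTensor A Y ≫ (q ▷ dual (A ⊗ Y) ≫ S.evt (A ⊗ Y)) := by
        rw [← whisker_exchange]; monoidal
    _ = (coev A ≫ g ▷ dual A ⊗≫ B ◁ dualTensor A Y ≫ B ◁ dualMap q) ≫ S.evt B := by
        rw [evt_dinatural]; monoidal
    _ = _ := by rw [← h2, rightTrace_eq]; simp

lemma rightTrace_comm {X Y : C} (f : X ⟶ Y) (g : Y ⟶ X) :
    S.rightTrace (f ≫ g) = S.rightTrace (g ≫ f) := by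
  rw [rightTrace_eq, rightTrace_eq, comp_whiskerRight, comp_whiskerRight]
  simp only [Category.assoc]
  rw [evt_dinatural, ← whisker_exchange_assoc, reassoc_of% coev_dinatural g,
    whisker_exchange_assoc]

lemma rightTrace_unit : S.rightTrace (𝟙 (𝟙_ C)) = 𝟙 _ := by
  rw [rightTrace_eq, coev_unit, evt, id_whiskerRight, Category.id_comp, Category.assoc,
    whisker_exchange_assoc, ← dualMap_ev, ← comp_whiskerRight_assoc, S.unit, dualUnit_ev,
    Iso.inv_hom_id]

/-- The morphism `Y* ⊗ Y ⟶ B* ⊗ B` obtained from an endomorphism of `B ⊗ Y*` by duality. -/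
def transpose {B Y : C} (G : B ⊗ dual Y ⟶ B ⊗ dual Y) : dual Y ⊗ Y ⟶ dual B ⊗ B :=
  𝟙 _ ⊗≫ S.coevt B ▷ (dual Y ⊗ Y) ⊗≫ dual B ◁ flat G

/-- Bending the strand `B` back with `evt` recovers `flat G`, and `sharp` then recovers `G`. -/
lemma transpose_injective {B Y : C} {G G' : B ⊗ dual Y ⟶ B ⊗ dual Y}
    (h : S.transpose G = S.transpose G') : G = G' := by
  have key (F : B ⊗ dual Y ⟶ B ⊗ dual Y) :
      B ◁ S.transpose F ⊗≫ S.evt B ▷ B = 𝟙 _ ⊗≫ flat F ⊗≫ 𝟙 _ := by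
    calc _ = 𝟙 _ ⊗≫ B ◁ S.coevt B ▷ (dual Y ⊗ Y) ⊗≫
          ((B ⊗ dual B) ◁ flat F ≫ S.evt B ▷ B) := by rw [transpose]; monoidal
      _ = 𝟙 _ ⊗≫ (B ◁ S.coevt B ⊗≫ S.evt B ▷ B) ▷ (dual Y ⊗ Y) ⊗≫ flat F ⊗≫ 𝟙 _ := by
        rw [whisker_exchange]; monoidal
      _ = _ := by rw [coevt_evt]; monoidal
  have hf : flat G = flat G' := by
    have e (F : B ⊗ dual Y ⟶ B ⊗ dual Y) :
        flat F = 𝟙 _ ⊗≫ (𝟙 _ ⊗≫ flat F ⊗≫ 𝟙 _ : B ⊗ dual Y ⊗ Y ⟶ 𝟙_ C ⊗ B) ⊗≫ 𝟙 _ := by monoidal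
    rw [e G, e G', ← key, ← key, h]
  rw [← sharp_flat G, hf, sharp_flat]

lemma transpose_id (B Y : C) : S.transpose (𝟙 (B ⊗ dual Y)) = ev Y ≫ S.coevt B := by
  calc _ = 𝟙 _ ⊗≫ (S.coevt B ▷ (dual Y ⊗ Y) ≫ (dual B ⊗ B) ◁ ev Y) ⊗≫ 𝟙 _ := by
        rw [transpose, flat]; monoidal
    _ = _ := by rw [← whisker_exchange]; monoidal

/-- The right side is the shape produced by the multiplication of `Z`: a pair `A*`, `A` is created
inside `Y*`, `Y`, and `A ⊗ Y` is then projected to `B`. Carrying `q` around the cup of `B` turns it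
into `dualMap q`. -/
lemma transpose_flatt_sharp {A B Y : C} (q : B ⟶ A ⊗ Y) (p : A ⊗ Y ⟶ B) :
    S.transpose (S.flatt q ≫ sharp p) = 𝟙 _ ⊗≫ dual Y ◁ S.coevt A ▷ Y ⊗≫
      dualTensor A Y ▷ (A ⊗ Y) ≫ dualMap q ▷ (A ⊗ Y) ≫ dual B ◁ p := by
  have h1 : flat (S.flatt q ≫ sharp p) = S.flatt q ▷ Y ≫ p := by
    conv_rhs => rw [← flat_sharp p]
    simp only [flat]; monoidal
  calc _ = 𝟙 _ ⊗≫ (S.coevt B ≫ dual B ◁ q) ▷ (dual Y ⊗ Y) ⊗≫ dual B ◁ A ◁ S.evt Y ▷ Y ⊗≫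
        dual B ◁ p := by rw [transpose, h1, flatt]; monoidal
    _ = 𝟙 _ ⊗≫ S.coevt Y ▷ (dual Y ⊗ Y) ⊗≫ dual Y ◁ S.coevt A ▷ (Y ⊗ dual Y ⊗ Y) ⊗≫
        ((dualTensor A Y ≫ dualMap q) ▷ (A ⊗ (Y ⊗ dual Y)) ≫
          dual B ◁ (A ◁ S.evt Y)) ▷ Y ⊗≫ dual B ◁ p := by
        rw [coevt_dinatural, coevt_tensor]; monoidal
    _ = 𝟙 _ ⊗≫ S.coevt Y ▷ (dual Y ⊗ Y) ⊗≫ (dual Y ◁ (S.coevt A ▷ (Y ⊗ dual Y) ≫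
        (dual A ⊗ A) ◁ S.evt Y)) ▷ Y ⊗≫
        (dualTensor A Y ≫ dualMap q) ▷ (A ⊗ Y) ⊗≫ dual B ◁ p := by
        rw [← whisker_exchange]; monoidal
    _ = 𝟙 _ ⊗≫ (S.coevt Y ▷ dual Y ⊗≫ dual Y ◁ S.evt Y) ▷ Y ⊗≫ dual Y ◁ S.coevt A ▷ Y ⊗≫
        (dualTensor A Y ≫ dualMap q) ▷ (A ⊗ Y) ⊗≫ dual B ◁ p := by
        rw [← whisker_exchange]; monoidal
    _ = _ := by rw [dual_coevt_evt]; monoidal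

end SovereignLemmas

end SovereignStructure

/-! ### The half braiding of a module over `Z`. -/

section HalfBraiding

variable {k : Type w} [CommRing k] {C : Type u} [Category.{v} C] [Preadditive C] [Linear k C]
  [HasFiniteBiproducts C] [MonoidalCategory C] [MonoidalPreadditive C] [MonoidalLinear k C]
  [RightRigidCategory C] {ι : Type*} [Fintype ι] {V : ι → C} {hV : IsFusionFamily k V}
  (M : (Zmonad hV).Algebra)

/-- The structure map of a `Z`-module, with its source written as `Zobj`. -/
def Zact : Zobj V M.A ⟶ M.A := M.a

lemma Zunit_Zact : Zunit hV M.A ≫ Zact M = 𝟙 M.A := M.unit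

lemma Zmul_Zact : Zmul hV M.A ≫ Zact M = Zmap V (Zact M) ≫ Zact M := M.assoc

/-- The component `Y* ⊗ M ⊗ Y ⟶ M` of the action on a `Z`-module. -/
def act (Y : C) : dual Y ⊗ (M.A ⊗ Y) ⟶ M.A := dinat hV M.A Y ≫ Zact M

lemma act_dinatural {Y Y' : C} (g : Y ⟶ Y') :
    dualMap g ▷ (M.A ⊗ Y) ≫ act M Y = dual Y' ◁ (M.A ◁ g) ≫ act M Y' := by
  rw [act, act, ← Category.assoc, dinat_dinatural, Category.assoc]

lemma act_unit : unitHom M.A ≫ act M (𝟙_ C) = 𝟙 M.A := by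
  rw [act, ← Category.assoc]
  exact Zunit_Zact M

lemma act_tensor (X Y : C) :
    mulHom M.A X Y ≫ act M (X ⊗ Y) = dual Y ◁ (act M X ▷ Y) ≫ act M Y := by
  rw [act, ← Category.assoc, ← dinat_Zmul, Category.assoc, Category.assoc, Zmul_Zact,
    ← Category.assoc (dinat hV (Zobj V M.A) Y), dinat_naturality, act, act, comp_whiskerRight,
    MonoidalCategory.whiskerLeft_comp, Category.assoc, Category.assoc]

/-- The half braiding `M ⊗ W ⟶ W ⊗ M` of a `Z`-module `M`. -/
def hb (W : C) : M.A ⊗ W ⟶ W ⊗ M.A := 𝟙 _ ⊗≫ coev W ▷ (M.A ⊗ W) ⊗≫ W ◁ act M W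

lemma hb_naturality {Y Y' : C} (g : Y ⟶ Y') :
    M.A ◁ g ≫ hb M Y' = hb M Y ≫ g ▷ M.A := by
  calc _ = 𝟙 _ ⊗≫ (𝟙_ C ◁ (M.A ◁ g) ≫ coev Y' ▷ (M.A ⊗ Y')) ⊗≫ Y' ◁ act M Y' := by
        rw [hb]; monoidal
    _ = 𝟙 _ ⊗≫ coev Y' ▷ (M.A ⊗ Y) ⊗≫ Y' ◁ (dual Y' ◁ (M.A ◁ g) ≫ act M Y') := by
        rw [whisker_exchange]; monoidal
    _ = 𝟙 _ ⊗≫ (coev Y' ≫ Y' ◁ dualMap g) ▷ (M.A ⊗ Y) ⊗≫ Y' ◁ act M Y := by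
        rw [← act_dinatural]; monoidal
    _ = 𝟙 _ ⊗≫ coev Y ▷ (M.A ⊗ Y) ⊗≫ (g ▷ (dual Y ⊗ (M.A ⊗ Y)) ≫ Y' ◁ act M Y) := by
        rw [← coev_dinatural]; monoidal
    _ = _ := by rw [← whisker_exchange, hb]; monoidal

/-- The hexagon axiom is associativity of the action (`act_tensor`) read through the coevaluations.
-/
lemma hb_tensor (X Y : C) :
    hb M (X ⊗ Y) = 𝟙 _ ⊗≫ hb M X ▷ Y ⊗≫ X ◁ hb M Y ⊗≫ 𝟙 _ := by
  calc _ = 𝟙 _ ⊗≫ coev X ▷ (M.A ⊗ (X ⊗ Y)) ⊗≫ X ◁ coev Y ▷ (dual X ⊗ (M.A ⊗ (X ⊗ Y))) ⊗≫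
        (X ⊗ Y) ◁ (mulHom M.A X Y ≫ act M (X ⊗ Y)) := by
        rw [hb, coev_tensor, mulHom]; monoidal
    _ = 𝟙 _ ⊗≫ coev X ▷ (M.A ⊗ (X ⊗ Y)) ⊗≫ X ◁ (coev Y ▷ (dual X ⊗ (M.A ⊗ X)) ≫
        (Y ⊗ dual Y) ◁ act M X) ▷ Y ⊗≫ (X ⊗ Y) ◁ act M Y := by
        rw [act_tensor]; monoidal
    _ = _ := by rw [← whisker_exchange, hb, hb]; monoidal

lemma hb_unit : hb M (𝟙_ C) = 𝟙 _ ⊗≫ 𝟙 M.A ⊗≫ 𝟙 _ := by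
  calc _ = 𝟙 _ ⊗≫ 𝟙_ C ◁ (unitHom M.A ≫ act M (𝟙_ C)) := by
        rw [hb, coev_unit, unitHom]; monoidal
    _ = _ := by rw [act_unit]; monoidal

lemma act_eq (W : C) : act M W = dual W ◁ hb M W ⊗≫ ev W ▷ M.A ⊗≫ 𝟙 _ := by
  symm
  calc _ = 𝟙 _ ⊗≫ dual W ◁ coev W ▷ (M.A ⊗ W) ⊗≫ ((dual W ⊗ W) ◁ act M W ≫ ev W ▷ M.A)
        ⊗≫ 𝟙 _ := by rw [hb]; monoidal
    _ = 𝟙 _ ⊗≫ (dual W ◁ coev W ⊗≫ ev W ▷ dual W) ▷ (M.A ⊗ W) ⊗≫ act M W := by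
        rw [whisker_exchange]; monoidal
    _ = _ := by rw [dual_coev_ev]; monoidal

variable (S : SovereignStructure C)

/-- The inverse of the half braiding. -/
def hbInv (W : C) : W ⊗ M.A ⟶ M.A ⊗ W :=
  𝟙 _ ⊗≫ (W ⊗ M.A) ◁ S.coevt W ⊗≫ W ◁ hb M (dual W) ▷ W ⊗≫ S.evt W ▷ (M.A ⊗ W) ⊗≫ 𝟙 _

lemma hb_hbInv (W : C) : hb M W ≫ hbInv M S W = 𝟙 _ := by
  -- Braiding `M` with `W` and then with `W*` is braiding it with `W ⊗ W*`, so naturality lets the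
  -- evaluation pass across `M`.
  have h : 𝟙 ((M.A ⊗ W) ⊗ dual W) ⊗≫ hb M W ▷ dual W ⊗≫ W ◁ hb M (dual W) ⊗≫ S.evt W ▷ M.A =
      𝟙 _ ⊗≫ M.A ◁ S.evt W ⊗≫ 𝟙 _ := by
    calc _ = 𝟙 _ ⊗≫ (hb M (W ⊗ dual W) ≫ S.evt W ▷ M.A) := by rw [hb_tensor]; monoidal
      _ = _ := by rw [← hb_naturality, hb_unit]; monoidal
  calc _ = 𝟙 _ ⊗≫ (hb M W ▷ 𝟙_ C ≫ (W ⊗ M.A) ◁ S.coevt W) ⊗≫ W ◁ hb M (dual W) ▷ W ⊗≫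
        S.evt W ▷ (M.A ⊗ W) ⊗≫ 𝟙 _ := by rw [hbInv]; monoidal
    _ = 𝟙 _ ⊗≫ M.A ◁ W ◁ S.coevt W ⊗≫ (𝟙 ((M.A ⊗ W) ⊗ dual W) ⊗≫ hb M W ▷ dual W ⊗≫
        W ◁ hb M (dual W) ⊗≫ S.evt W ▷ M.A) ▷ W ⊗≫ 𝟙 _ := by
        rw [← whisker_exchange]; monoidal
    _ = 𝟙 _ ⊗≫ M.A ◁ (W ◁ S.coevt W ⊗≫ S.evt W ▷ W) ⊗≫ 𝟙 _ := by rw [h]; monoidal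
    _ = _ := by rw [S.coevt_evt]; monoidal

lemma hbInv_hb (W : C) : hbInv M S W ≫ hb M W = 𝟙 _ := by
  have h : 𝟙 (M.A ⊗ 𝟙_ C) ⊗≫ M.A ◁ S.coevt W ⊗≫ hb M (dual W) ▷ W ⊗≫ dual W ◁ hb M W =
      𝟙 _ ⊗≫ S.coevt W ▷ M.A ⊗≫ 𝟙 _ := by
    calc _ = 𝟙 _ ⊗≫ (M.A ◁ S.coevt W ≫ hb M (dual W ⊗ W)) ⊗≫ 𝟙 _ := by
          rw [hb_tensor]; monoidal
      _ = _ := by rw [hb_naturality, hb_unit]; monoidal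
  calc _ = 𝟙 _ ⊗≫ (W ⊗ M.A) ◁ S.coevt W ⊗≫ W ◁ hb M (dual W) ▷ W ⊗≫
        (S.evt W ▷ (M.A ⊗ W) ≫ 𝟙_ C ◁ hb M W) ⊗≫ 𝟙 _ := by rw [hbInv]; monoidal
    _ = 𝟙 _ ⊗≫ W ◁ (𝟙 (M.A ⊗ 𝟙_ C) ⊗≫ M.A ◁ S.coevt W ⊗≫ hb M (dual W) ▷ W ⊗≫
        dual W ◁ hb M W) ⊗≫ S.evt W ▷ (W ⊗ M.A) ⊗≫ 𝟙 _ := by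
        rw [← whisker_exchange]; monoidal
    _ = 𝟙 _ ⊗≫ (W ◁ S.coevt W ⊗≫ S.evt W ▷ W) ▷ M.A ⊗≫ 𝟙 _ := by rw [h]; monoidal
    _ = _ := by rw [S.coevt_evt]; monoidal

lemma hbInv_naturality {Y Y' : C} (g : Y ⟶ Y') :
    g ▷ M.A ≫ hbInv M S Y' = hbInv M S Y ≫ M.A ◁ g := by
  rw [← Category.id_comp (g ▷ M.A ≫ _), ← hbInv_hb M S Y, Category.assoc,
    ← reassoc_of% hb_naturality M g, hb_hbInv, Category.comp_id]

/-- Instead of moving only `A` back across `M`, move `Y` across first and then return `A ⊗ Y` as a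
whole; by naturality this return can take place after `p`. -/
lemma hbInv_whiskerRight {A B Y : C} (p : A ⊗ Y ⟶ B) :
    hbInv M S A ▷ Y ⊗≫ M.A ◁ p = 𝟙 _ ⊗≫ A ◁ hb M Y ⊗≫ p ▷ M.A ≫ hbInv M S B := by
  rw [hbInv_naturality]
  symm
  calc _ = 𝟙 _ ⊗≫ (𝟙 (A ⊗ M.A)) ▷ Y ⊗≫ A ◁ hb M Y ⊗≫ hbInv M S (A ⊗ Y) ≫ M.A ◁ p := by monoidal
    _ = hbInv M S A ▷ Y ⊗≫ (hb M (A ⊗ Y) ≫ hbInv M S (A ⊗ Y)) ≫ M.A ◁ p := by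
        rw [← hbInv_hb M S, hb_tensor]; monoidal
    _ = _ := by rw [hb_hbInv]; monoidal

/-- The map `M ⟶ W* ⊗ M ⊗ W` which creates a pair `W*`, `W` and moves `W` across `M`. -/
def coact (W : C) : M.A ⟶ dual W ⊗ (M.A ⊗ W) :=
  𝟙 _ ⊗≫ S.coevt W ▷ M.A ⊗≫ dual W ◁ hbInv M S W

lemma coact_act (W : C) :
    coact M S W ≫ act M W = 𝟙 _ ⊗≫ S.leftTrace (𝟙 W) ▷ M.A ⊗≫ 𝟙 _ := by
  calc _ = 𝟙 _ ⊗≫ S.coevt W ▷ M.A ⊗≫ dual W ◁ (hbInv M S W ≫ hb M W) ⊗≫ ev W ▷ M.A ⊗≫ 𝟙 _ := by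
        rw [coact, act_eq]; monoidal
    _ = _ := by rw [hbInv_hb, S.leftTrace_eq]; monoidal

/-- This and `coact_mulHom` bring the two sides of Z-linearity to a common form in which only the
map Y* ⊗ Y ⟶ B* ⊗ B in the middle differs. -/
lemma act_coact (Y B : C) :
    act M Y ≫ coact M S B = 𝟙 _ ⊗≫ dual Y ◁ hb M Y ⊗≫ S.transpose (𝟙 (B ⊗ dual Y)) ▷ M.A ⊗≫
      dual B ◁ hbInv M S B := by
  rw [act_eq, coact, S.transpose_id]; monoidal

lemma coact_mulHom {A B Y : C} (q : B ⟶ A ⊗ Y) (p : A ⊗ Y ⟶ B) :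
    dual Y ◁ (coact M S A ▷ Y) ≫ mulHom M.A A Y ≫ (dualMap q ⊗ₘ M.A ◁ p) =
      𝟙 _ ⊗≫ dual Y ◁ hb M Y ⊗≫ S.transpose (S.flatt q ≫ sharp p) ▷ M.A ⊗≫
        dual B ◁ hbInv M S B := by
  calc _ = 𝟙 _ ⊗≫ dual Y ◁ (S.coevt A ▷ (M.A ⊗ Y)) ⊗≫
        ((dual Y ⊗ dual A) ◁ (hbInv M S A ▷ Y ⊗≫ M.A ◁ p) ≫
          (dualTensor A Y ≫ dualMap q) ▷ (M.A ⊗ B)) := by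
        rw [coact, mulHom, MonoidalCategory.tensorHom_def']
        calc _ = 𝟙 _ ⊗≫ dual Y ◁ (S.coevt A ▷ (M.A ⊗ Y)) ⊗≫
              ((dual Y ⊗ dual A) ◁ (hbInv M S A ▷ Y) ⊗≫
              (dualTensor A Y ▷ (M.A ⊗ (A ⊗ Y)) ≫ dual (A ⊗ Y) ◁ (M.A ◁ p)) ≫
              dualMap q ▷ (M.A ⊗ B)) := by monoidal
          _ = _ := by rw [← whisker_exchange]; monoidal
    _ = 𝟙 _ ⊗≫ dual Y ◁ (S.coevt A ▷ (M.A ⊗ Y) ≫ (dual A ⊗ A) ◁ hb M Y) ⊗≫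
        ((dual Y ⊗ dual A) ◁ (p ▷ M.A ≫ hbInv M S B) ≫
          (dualTensor A Y ≫ dualMap q) ▷ (M.A ⊗ B)) := by
        rw [hbInv_whiskerRight]; monoidal
    _ = 𝟙 _ ⊗≫ dual Y ◁ (𝟙_ C ◁ hb M Y ≫ S.coevt A ▷ (Y ⊗ M.A)) ⊗≫
        ((dualTensor A Y ≫ dualMap q) ▷ ((A ⊗ Y) ⊗ M.A) ≫
          dual B ◁ (p ▷ M.A ≫ hbInv M S B)) := by
        rw [whisker_exchange, whisker_exchange]
    _ = _ := by rw [S.transpose_flatt_sharp]; monoidal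

end HalfBraiding

/-! ### Isotypic components and the averaging operator. -/

section Isotypic

variable {k : Type w} [CommRing k] {C : Type u} [Category.{v} C] [Preadditive C] [Linear k C]
  [HasFiniteBiproducts C] [MonoidalCategory C] [MonoidalPreadditive C] [MonoidalLinear k C]
  [RightRigidCategory C] {ι : Type*} {V : ι → C} (hV : IsFusionFamily k V)

namespace IsFusionFamily

lemma scalar_smul (f : 𝟙_ C ⟶ 𝟙_ C) : hV.scalar f • 𝟙 (𝟙_ C) = f :=
  (Equiv.ofBijective _ hV.unit_bijective).apply_symm_apply f

lemma scalar_one : hV.scalar (𝟙 (𝟙_ C)) = 1 :=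
  hV.unit_bijective.1 ((hV.scalar_smul _).trans (one_smul _ _).symm)

open Classical in
/-- The inclusions of the summands of `W` with label `j`, and `0` for the other summands. -/
def isoIncl (W : C) (j : ι) (a : Fin (hV.num W)) : V j ⟶ W :=
  if h : hV.label W a = j then eqToHom (by rw [h]) ≫ hV.q W a else 0

open Classical in
/-- The projections to the summands of `W` with label `j`, and `0` for the other summands. -/
def isoProj (W : C) (j : ι) (a : Fin (hV.num W)) : W ⟶ V j :=
  if h : hV.label W a = j then hV.p W a ≫ eqToHom (by rw [h]) else 0

/-- Summands with a label other than `j` have no nonzero map to `V j`, so dropping them changes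
nothing. -/
lemma sum_isoProj_isoIncl {W : C} {j : ι} (f : W ⟶ V j) :
    ∑ a, hV.isoProj W j a ≫ hV.isoIncl W j a ≫ f = f := by
  conv_rhs => rw [← Category.id_comp f, ← hV.sum_p_q, Preadditive.sum_comp]
  refine Finset.sum_congr rfl fun a _ => ?_
  by_cases h : hV.label W a = j
  · simp [isoProj, isoIncl, h]
  · simp [isoProj, isoIncl, h, hV.hom_eq_zero _ _ h (hV.q W a ≫ f)]

lemma hom_ext (hV : IsFusionFamily k V) {X W : C} {f g : X ⟶ W}
    (h : ∀ l (q : V l ⟶ X), q ≫ f = q ≫ g) : f = g := by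
  rw [← Category.id_comp f, ← Category.id_comp g, ← hV.sum_p_q, Preadditive.sum_comp,
    Preadditive.sum_comp]
  simp only [Category.assoc, h]

end IsFusionFamily

variable [Fintype ι]

lemma Zobj_hom_ext {X W : C} {f g : W ⟶ Zobj V X} (h : ∀ j, f ≫ Zπ V X j = g ≫ Zπ V X j) :
    f = g :=
  biproduct.hom_ext _ _ h

open Classical in
lemma tensorHom_Zι_Zπ (X : C) {W : C} {l : ι} (q : V l ⟶ W) (p : W ⟶ V l) (j : ι) :
    (dualMap q ⊗ₘ X ◁ p) ≫ Zι V X l ≫ Zπ V X j =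
      (dualMap (if h : l = j then eqToHom (by rw [h]) ≫ q else 0) ⊗ₘ
        X ◁ (if h : l = j then p ≫ eqToHom (by rw [h]) else 0)) := by
  by_cases h : l = j
  · subst h
    simp [Zι_π]
  · simp [h, Zι_π_ne V X h, dualMap_zero]

lemma dinat_Zπ (X W : C) (j : ι) :
    dinat hV X W ≫ Zπ V X j =
      ∑ a, (dualMap (hV.isoIncl W j a) ⊗ₘ X ◁ hV.isoProj W j a) := by
  rw [dinat, Preadditive.sum_comp]
  refine Finset.sum_congr rfl fun a _ => ?_
  rw [Category.assoc, tensorHom_Zι_Zπ]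
  rfl

variable (S : SovereignStructure C)

/-- The right dimension of `V i` as a scalar. -/
def rdim (i : ι) : k := hV.scalar (S.rightTrace (𝟙 (V i)))

/-- The left dimension of `V i` as a scalar. -/
def ldim (i : ι) : k := hV.scalar (S.leftTrace (𝟙 (V i)))

lemma rightTrace_smul_id (c : k) (i : ι) :
    S.rightTrace (c • 𝟙 (V i)) = (c * rdim hV S i) • 𝟙 (𝟙_ C) := by
  have h : S.rightTrace (c • 𝟙 (V i)) = c • S.rightTrace (𝟙 (V i)) := by
    simp [SovereignStructure.rightTrace_eq, MonoidalLinear.smul_whiskerRight]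
  rw [h, mul_smul, rdim, hV.scalar_smul]

lemma sharp_smul {A B Y : C} (c : k) (p : A ⊗ Y ⟶ B) : sharp (c • p) = c • sharp p := by
  simp [sharp, monoidalComp, MonoidalLinear.smul_whiskerRight]

lemma sharp_sum {A B Y : C} {α : Type*} (s : Finset α) (p : α → (A ⊗ Y ⟶ B)) :
    sharp (∑ a ∈ s, p a) = ∑ a ∈ s, sharp (p a) := by
  simp [sharp, monoidalComp, CategoryTheory.sum_whiskerRight, Preadditive.comp_sum]

lemma transpose_smul {B Y : C} (c : k) (G : B ⊗ dual Y ⟶ B ⊗ dual Y) :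
    S.transpose (c • G) = c • S.transpose G := by
  simp [SovereignStructure.transpose, flat, monoidalComp, MonoidalLinear.smul_whiskerRight,
    MonoidalLinear.whiskerLeft_smul]

lemma transpose_sum {B Y : C} {α : Type*} (s : Finset α) (G : α → (B ⊗ dual Y ⟶ B ⊗ dual Y)) :
    S.transpose (∑ a ∈ s, G a) = ∑ a ∈ s, S.transpose (G a) := by
  simp [SovereignStructure.transpose, flat, monoidalComp, CategoryTheory.sum_whiskerRight,
    CategoryTheory.whiskerLeft_sum, Preadditive.comp_sum, Preadditive.sum_comp]

/-- The endomorphism of `V j ⊗ Y*` obtained by letting `Y` act on the element of `Hom(𝟙, Z(𝟙))` with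
coordinates `c`. That element is `Z`-linear if and only if this is always `c j • 𝟙`. -/
def averaging (c : ι → k) (j : ι) (Y : C) : V j ⊗ dual Y ⟶ V j ⊗ dual Y :=
  ∑ i, ∑ a, c i • (S.flatt (hV.isoIncl (V i ⊗ Y) j a) ≫ sharp (hV.isoProj (V i ⊗ Y) j a))

lemma comp_averaging (c : ι → k) (t : k) {j l : ι} {Y : C} (g : V l ⟶ V j ⊗ dual Y)
    (h : c l = t * rdim hV S l) : g ≫ averaging hV S c j Y = (t * rdim hV S j) • g := by
  have h1 (a) : c l • (g ≫ S.flatt (hV.isoIncl (V l ⊗ Y) j a) ≫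
      sharp (hV.isoProj (V l ⊗ Y) j a)) = (t * rdim hV S j) •
        sharp (hV.isoProj (V l ⊗ Y) j a ≫ hV.isoIncl (V l ⊗ Y) j a ≫ flat g) := by
    obtain ⟨x, hx⟩ := (hV.end_bijective l).2 (g ≫ S.flatt (hV.isoIncl (V l ⊗ Y) j a))
    obtain ⟨y, hy⟩ := (hV.end_bijective j).2 (hV.isoIncl (V l ⊗ Y) j a ≫ flat g)
    dsimp only at hx hy
    -- `x` and `y` come from the two cyclic arrangements of `g` and the inclusion, whose right
    -- traces agree.
    have hxy : x * rdim hV S l = y * rdim hV S j := by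
      apply hV.unit_bijective.1
      dsimp only
      rw [← rightTrace_smul_id, ← rightTrace_smul_id, hx, hy, S.rightTrace_comp_flatt]
    rw [← Category.assoc, ← hx, ← hy, Linear.smul_comp, Linear.comp_smul, sharp_smul,
      Category.id_comp, Category.comp_id, smul_smul, smul_smul, h, mul_assoc, mul_assoc,
      mul_comm _ x, hxy, mul_comm y]
  rw [averaging, Preadditive.comp_sum, Finset.sum_eq_single l]
  · simp only [Preadditive.comp_sum, Linear.comp_smul, h1]
    rw [← Finset.smul_sum, ← sharp_sum, hV.sum_isoProj_isoIncl, sharp_flat]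
  · intro i _ hi
    rw [Preadditive.comp_sum]
    refine Finset.sum_eq_zero fun a _ => ?_
    rw [Linear.comp_smul, ← Category.assoc,
      hV.hom_eq_zero l i hi.symm (g ≫ S.flatt (hV.isoIncl (V i ⊗ Y) j a)), zero_comp, smul_zero]
  · simp

/-- An endomorphism is determined by its composites with maps out of the `V l`, and for the weights
`rdim` every `l` satisfies the hypothesis of `comp_averaging` with t = 1. -/
lemma averaging_rdim (j : ι) (Y : C) :
    averaging hV S (rdim hV S) j Y = rdim hV S j • 𝟙 _ := by
  apply hV.hom_ext
  intro l q
  rw [comp_averaging hV S _ 1 q (one_mul _).symm, one_mul, Linear.comp_smul, Category.comp_id]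

end Isotypic

/-! ### Averaging over `Z`: an invertible dimension implies semisimplicity. -/

section Maschke

variable {k : Type w} [CommRing k] {C : Type u} [Category.{v} C] [Preadditive C] [Linear k C]
  [HasFiniteBiproducts C] [MonoidalCategory C] [MonoidalPreadditive C] [MonoidalLinear k C]
  [RightRigidCategory C] {ι : Type*} [Fintype ι] {V : ι → C} (hV : IsFusionFamily k V)
  (S : SovereignStructure C)

variable (V) in
lemma Zι_Zmap {X X' : C} (f : X ⟶ X') (i : ι) :
    Zι V X i ≫ Zmap V f = dual (V i) ◁ (f ▷ V i) ≫ Zι V X' i :=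
  biproduct.ι_map (f := fun i => dual (V i) ⊗ (X ⊗ V i)) (g := fun i => dual (V i) ⊗ (X' ⊗ V i))
    (fun i => dual (V i) ◁ (f ▷ V i)) i

variable (V) in
lemma Zmap_smul (c : k) {X X' : C} (f : X ⟶ X') : Zmap V (c • f) = c • Zmap V f := by
  refine biproduct.hom_ext' _ _ fun i => ?_
  change Zι V X i ≫ Zmap V (c • f) = Zι V X i ≫ (c • Zmap V f)
  rw [Linear.comp_smul, Zι_Zmap, Zι_Zmap, MonoidalLinear.smul_whiskerRight,
    MonoidalLinear.whiskerLeft_smul, Linear.smul_comp]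

/-- The averaging map `M ⟶ Z(M)` of a `Z`-module `M`. -/
def average (M : (Zmonad hV).Algebra) : M.A ⟶ Zobj V M.A :=
  ∑ i, rdim hV S i • (coact M S (V i) ≫ Zι V M.A i)

lemma average_Zπ (M : (Zmonad hV).Algebra) (j : ι) :
    average hV S M ≫ Zπ V M.A j = rdim hV S j • coact M S (V j) := by
  rw [average, Preadditive.sum_comp, Finset.sum_eq_single j]
  · rw [Linear.smul_comp, Category.assoc, Zι_π, Category.comp_id]
  · intro i _ hi
    rw [Linear.smul_comp, Category.assoc, Zι_π_ne V M.A hi, comp_zero, smul_zero]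
  · simp

lemma dim_eq : S.dim hV = ∑ i, ldim hV S i * rdim hV S i := rfl

/-- Moving V_i across M and back cancels, leaving a free loop of value dim_l(V_i), already weighted
by dim_r(V_i). -/
lemma average_Zact (M : (Zmonad hV).Algebra) :
    average hV S M ≫ Zact M = S.dim hV • 𝟙 M.A := by
  have h (i) : Zι V M.A i ≫ Zact M = act M (V i) := by rw [act, dinat_simple]
  have h' (i) : coact M S (V i) ≫ act M (V i) = ldim hV S i • 𝟙 M.A := by
    rw [coact_act, ← hV.scalar_smul (S.leftTrace (𝟙 (V i)))]
    simp [monoidalComp, MonoidalLinear.smul_whiskerRight, ldim]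
  rw [average, Preadditive.sum_comp, dim_eq, Finset.sum_smul]
  refine Finset.sum_congr rfl fun i _ => ?_
  rw [Linear.smul_comp, Category.assoc, h, h', smul_smul, mul_comm]

/-- The morphism `Y* ⊗ M ⊗ Y ⟶ B* ⊗ M ⊗ B` obtained from `F : Y* ⊗ Y ⟶ B* ⊗ B` by moving `M` to
the right of `Y` and back to the left of `B`. -/
def conjMap (M : (Zmonad hV).Algebra) {Y B : C} (F : dual Y ⊗ Y ⟶ dual B ⊗ B) :
    dual Y ⊗ (M.A ⊗ Y) ⟶ dual B ⊗ (M.A ⊗ B) :=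
  𝟙 _ ⊗≫ dual Y ◁ hb M Y ⊗≫ F ▷ M.A ⊗≫ dual B ◁ hbInv M S B

lemma conjMap_smul (M : (Zmonad hV).Algebra) {Y B : C} (c : k) (F : dual Y ⊗ Y ⟶ dual B ⊗ B) :
    conjMap hV S M (c • F) = c • conjMap hV S M F := by
  simp [conjMap, monoidalComp, MonoidalLinear.smul_whiskerRight]

lemma conjMap_sum (M : (Zmonad hV).Algebra) {Y B : C} {α : Type*} (s : Finset α)
    (F : α → (dual Y ⊗ Y ⟶ dual B ⊗ B)) :
    conjMap hV S M (∑ a ∈ s, F a) = ∑ a ∈ s, conjMap hV S M (F a) := by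
  simp [conjMap, monoidalComp, CategoryTheory.sum_whiskerRight, Preadditive.comp_sum,
    Preadditive.sum_comp]

/-- Z-linearity of the averaging map, checked on each component `Y` of the coend and each summand
`j`. There both sides are `conjMap` of a transpose, so the claim reduces to `averaging_rdim`. -/
lemma Zmap_average (M : (Zmonad hV).Algebra) :
    Zmap V (average hV S M) ≫ Zmul hV M.A = Zact M ≫ average hV S M := by
  refine dinat_hom_ext hV (𝟭 C) _ fun Y => ?_
  change dinat hV M.A Y ≫ Zmap V (average hV S M) ≫ Zmul hV M.A =
    dinat hV M.A Y ≫ Zact M ≫ average hV S M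
  apply Zobj_hom_ext
  intro j
  have hR : (dinat hV M.A Y ≫ Zact M ≫ average hV S M) ≫ Zπ V M.A j =
      conjMap hV S M (S.transpose (rdim hV S j • 𝟙 _)) := by
    rw [Category.assoc, Category.assoc, average_Zπ, ← Category.assoc, Linear.comp_smul,
      transpose_smul, conjMap_smul]
    exact congrArg _ (act_coact M S Y (V j))
  have hL : (dinat hV M.A Y ≫ Zmap V (average hV S M) ≫ Zmul hV M.A) ≫ Zπ V M.A j =
      conjMap hV S M (S.transpose (averaging hV S (rdim hV S) j Y)) := by
    have h1 (i) : dual Y ◁ ((coact M S (V i) ≫ Zι V M.A i) ▷ Y) ≫ dinat hV (Zobj V M.A) Y ≫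
        Zmul hV M.A ≫ Zπ V M.A j = ∑ a, dual Y ◁ (coact M S (V i) ▷ Y) ≫ mulHom M.A (V i) Y ≫
          (dualMap (hV.isoIncl (V i ⊗ Y) j a) ⊗ₘ M.A ◁ hV.isoProj (V i ⊗ Y) j a) := by
      have h2 := congrArg (· ≫ Zπ V M.A j) (dinat_Zmul hV M.A (V i) Y)
      simp only [Category.assoc, dinat_Zπ, dinat_simple, Preadditive.comp_sum] at h2
      rw [comp_whiskerRight, MonoidalCategory.whiskerLeft_comp, Category.assoc, h2,
        Preadditive.comp_sum]
    rw [← Category.assoc, dinat_naturality]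
    simp only [Category.assoc]
    rw [average, CategoryTheory.sum_whiskerRight, CategoryTheory.whiskerLeft_sum,
      Preadditive.sum_comp, averaging, transpose_sum, conjMap_sum]
    refine Finset.sum_congr rfl fun i _ => ?_
    rw [MonoidalLinear.smul_whiskerRight, MonoidalLinear.whiskerLeft_smul, Linear.smul_comp, h1,
      transpose_sum, conjMap_sum, Finset.smul_sum]
    refine Finset.sum_congr rfl fun a _ => ?_
    rw [transpose_smul, conjMap_smul, coact_mulHom]
    rfl
  rw [hL, hR, averaging_rdim]

theorem isSemisimpleMonad_of_isUnit_dim (h : IsUnit (S.dim hV)) :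
    IsSemisimpleMonad (Zmonad hV) := by
  intro M
  obtain ⟨d, hd⟩ := h
  have h1 : Zmap V ((↑d⁻¹ : k) • average hV S M) ≫ Zmul hV M.A =
      Zact M ≫ ((↑d⁻¹ : k) • average hV S M) := by
    rw [Linear.comp_smul, ← Zmap_average, Zmap_smul, Linear.smul_comp]
  have h2 : ((↑d⁻¹ : k) • average hV S M) ≫ Zact M = 𝟙 M.A := by
    rw [Linear.smul_comp, average_Zact, ← hd, smul_smul, Units.inv_mul, one_smul]
  exact ⟨M.A, ⟨⟨⟨(↑d⁻¹ : k) • average hV S M, h1⟩, ⟨Zact M, (Zmul_Zact M).symm⟩,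
    Monad.Algebra.Hom.ext h2⟩⟩⟩

end Maschke

/-! ### The unit module: semisimplicity implies an invertible dimension. -/

section UnitModule

variable {k : Type w} [CommRing k] {C : Type u} [Category.{v} C] [Preadditive C] [Linear k C]
  [HasFiniteBiproducts C] [MonoidalCategory C] [MonoidalPreadditive C] [MonoidalLinear k C]
  [RightRigidCategory C] {ι : Type*} [Fintype ι] {V : ι → C} (hV : IsFusionFamily k V)

variable (V) in
/-- The action `Z(𝟙) ⟶ 𝟙` given by the evaluations. -/
def Zev : Zobj V (𝟙_ C) ⟶ 𝟙_ C := ∑ i, Zπ V (𝟙_ C) i ≫ dual (V i) ◁ (λ_ (V i)).hom ≫ ev (V i)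

lemma dinat_Zev (Y : C) : dinat hV (𝟙_ C) Y ≫ Zev V = dual Y ◁ (λ_ Y).hom ≫ ev Y := by
  refine dinat_desc hV (𝟭 C) (𝟙_ C) (fun Y => dual Y ◁ (λ_ Y).hom ≫ ev Y) ?_ Y
  intro Y Y' g
  change dualMap g ▷ (𝟙_ C ⊗ Y) ≫ dual Y ◁ (λ_ Y).hom ≫ ev Y =
    dual Y' ◁ (𝟙_ C ◁ g) ≫ dual Y' ◁ (λ_ Y').hom ≫ ev Y'
  rw [← whisker_exchange_assoc, dualMap_ev, ← MonoidalCategory.whiskerLeft_comp_assoc,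
    ← MonoidalCategory.whiskerLeft_comp_assoc, leftUnitor_naturality]

lemma Zunit_Zev : Zunit hV (𝟙_ C) ≫ Zev V = 𝟙 (𝟙_ C) := by
  rw [Zunit, Category.assoc, dinat_Zev]
  calc _ = 𝟙 _ ⊗≫ (dualUnit ▷ (𝟙_ C) ≫ ev (𝟙_ C)) := by rw [unitHom]; monoidal
    _ = _ := by rw [dualUnit_ev]; monoidal

lemma Zmul_Zev : Zmul hV (𝟙_ C) ≫ Zev V = Zmap V (Zev V) ≫ Zev V := by
  refine dinat_hom_ext hV (𝟭 C) _ fun Y₂ => ?_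
  refine dinat_hom_ext hV (conj Y₂) _ fun Y₁ => ?_
  change dual Y₂ ◁ (dinat hV (𝟙_ C) Y₁ ▷ Y₂) ≫ dinat hV (Zobj V (𝟙_ C)) Y₂ ≫
      Zmul hV (𝟙_ C) ≫ Zev V =
    dual Y₂ ◁ (dinat hV (𝟙_ C) Y₁ ▷ Y₂) ≫ dinat hV (Zobj V (𝟙_ C)) Y₂ ≫ Zmap V (Zev V) ≫ Zev V
  have h := congrArg (· ≫ Zev V) (dinat_Zmul hV (𝟙_ C) Y₁ Y₂)
  simp only [Category.assoc] at h
  rw [h, dinat_Zev, ← Category.assoc (dinat hV (Zobj V (𝟙_ C)) Y₂), dinat_naturality,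
    Category.assoc, dinat_Zev, ← MonoidalCategory.whiskerLeft_comp_assoc, ← comp_whiskerRight,
    dinat_Zev]
  calc _ = 𝟙 _ ⊗≫ (dualTensor Y₁ Y₂ ▷ (Y₁ ⊗ Y₂) ≫ ev (Y₁ ⊗ Y₂)) := by rw [mulHom]; monoidal
    _ = _ := by rw [dualTensor_ev, evNested]; monoidal

/-- The unit object as a `Z`-module. -/
def unitModule : (Zmonad hV).Algebra where
  A := 𝟙_ C
  a := Zev V
  unit := Zunit_Zev hV
  assoc := Zmul_Zev hV

variable (S : SovereignStructure C)

/-- The coevaluation `𝟙 ⟶ Y* ⊗ 𝟙 ⊗ Y`. -/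
def coevtUnit (Y : C) : 𝟙_ C ⟶ dual Y ⊗ (𝟙_ C ⊗ Y) := S.coevt Y ≫ dual Y ◁ (λ_ Y).inv

/-- Duality identifies Hom(𝟙, V_i* ⊗ V_i) with End(V_i) = k • 𝟙, where the coevaluation corresponds
to the identity. -/
lemma exists_eq_smul_coevtUnit (hV : IsFusionFamily k V) (i : ι)
    (f : 𝟙_ C ⟶ dual (V i) ⊗ (𝟙_ C ⊗ V i)) :
    ∃ c : k, f = c • coevtUnit S (V i) := by
  obtain ⟨c, hc⟩ := (hV.end_bijective i).2
    (𝟙 (V i) ⊗≫ V i ◁ f ⊗≫ S.evt (V i) ▷ V i ⊗≫ 𝟙 _)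
  refine ⟨c, ?_⟩
  dsimp only at hc
  have h : f = 𝟙 _ ⊗≫ S.coevt (V i) ⊗≫
      dual (V i) ◁ (𝟙 (V i) ⊗≫ V i ◁ f ⊗≫ S.evt (V i) ▷ V i ⊗≫ 𝟙 (V i)) ⊗≫ 𝟙 _ := by
    symm
    calc _ = 𝟙 _ ⊗≫ (S.coevt (V i) ▷ 𝟙_ C ≫ (dual (V i) ⊗ V i) ◁ f) ⊗≫
          dual (V i) ◁ S.evt (V i) ▷ V i ⊗≫ 𝟙 _ := by monoidal
      _ = 𝟙 _ ⊗≫ f ⊗≫ (S.coevt (V i) ▷ dual (V i) ⊗≫ dual (V i) ◁ S.evt (V i)) ▷ V i ⊗≫ 𝟙 _ := by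
          rw [← whisker_exchange]; monoidal
      _ = _ := by rw [S.dual_coevt_evt]; monoidal
  rw [h, ← hc]
  simp [coevtUnit, monoidalComp, MonoidalLinear.whiskerLeft_smul]

/-- The analogue of `coact_mulHom` for the unit object, where the half braidings reduce to unitors.
-/
lemma coevtUnit_mulHom {A B Y : C} (q : B ⟶ A ⊗ Y) (p : A ⊗ Y ⟶ B) :
    dual Y ◁ (coevtUnit S A ▷ Y) ≫ mulHom (𝟙_ C) A Y ≫ (dualMap q ⊗ₘ 𝟙_ C ◁ p) =
      dual Y ◁ (λ_ Y).hom ≫ S.transpose (S.flatt q ≫ sharp p) ≫ dual B ◁ (λ_ B).inv := by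
  rw [S.transpose_flatt_sharp, coevtUnit, mulHom, MonoidalCategory.tensorHom_def]
  monoidal

/-- A triangle identity turns a multiple of `coev (V j)` into the same multiple of `𝟙 (V j)`, which
generates End(V_j) freely. -/
lemma smul_coev_injective (hV : IsFusionFamily k V) {j : ι} {a b : k}
    (h : a • coev (V j) = b • coev (V j)) : a = b := by
  apply (hV.end_bijective j).1
  have e (c : k) : c • 𝟙 (V j) = 𝟙 _ ⊗≫ ((c • coev (V j)) ▷ V j ⊗≫ V j ◁ ev (V j)) ⊗≫ 𝟙 _ := by
    have : (c • coev (V j)) ▷ V j ⊗≫ V j ◁ ev (V j) =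
        c • (coev (V j) ▷ V j ⊗≫ V j ◁ ev (V j)) := by
      simp [monoidalComp, MonoidalLinear.smul_whiskerRight]
    rw [this, coev_ev]
    simp [monoidalComp]
  dsimp only
  rw [e a, e b, h]

/-- An element of `Hom(𝟙, Z(𝟙))` is `Z`-linear only if its coordinates are proportional to the
dimensions. -/
lemma coord_eq_of_linear {Λ : 𝟙_ C ⟶ Zobj V (𝟙_ C)}
    (hΛ : Zmap V Λ ≫ Zmul hV (𝟙_ C) = Zev V ≫ Λ) {c : ι → k}
    (hc : ∀ i, Λ ≫ Zπ V (𝟙_ C) i = c i • coevtUnit S (V i)) :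
    ∃ t : k, ∀ j, c j = t * rdim hV S j := by
  have hsum : Λ = ∑ i, c i • (coevtUnit S (V i) ≫ Zι V (𝟙_ C) i) := by
    rw [← Category.comp_id Λ, ← Z_total, Preadditive.comp_sum]
    refine Finset.sum_congr rfl fun i _ => ?_
    rw [← Category.assoc, hc, Linear.smul_comp]
  -- Linearity of `Λ`, restricted to the component `Y` and projected to the summand `j`, is this
  -- identity after transposition.
  have key (j : ι) (Y : C) : averaging hV S c j Y = c j • 𝟙 _ := by
    apply S.transpose_injective
    have h1 (i) : dual Y ◁ ((coevtUnit S (V i) ≫ Zι V (𝟙_ C) i) ▷ Y) ≫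
        dinat hV (Zobj V (𝟙_ C)) Y ≫ Zmul hV (𝟙_ C) ≫ Zπ V (𝟙_ C) j =
        ∑ a, dual Y ◁ (coevtUnit S (V i) ▷ Y) ≫ mulHom (𝟙_ C) (V i) Y ≫
          (dualMap (hV.isoIncl (V i ⊗ Y) j a) ⊗ₘ 𝟙_ C ◁ hV.isoProj (V i ⊗ Y) j a) := by
      have h2 := congrArg (· ≫ Zπ V (𝟙_ C) j) (dinat_Zmul hV (𝟙_ C) (V i) Y)
      simp only [Category.assoc, dinat_Zπ, dinat_simple, Preadditive.comp_sum] at h2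
      rw [comp_whiskerRight, MonoidalCategory.whiskerLeft_comp, Category.assoc, h2,
        Preadditive.comp_sum]
    have hL : dinat hV (𝟙_ C) Y ≫ (Zmap V Λ ≫ Zmul hV (𝟙_ C)) ≫ Zπ V (𝟙_ C) j =
        dual Y ◁ (λ_ Y).hom ≫ S.transpose (averaging hV S c j Y) ≫
          dual (V j) ◁ (λ_ (V j)).inv := by
      rw [Category.assoc, ← Category.assoc, dinat_naturality]
      simp only [Category.assoc]
      rw [hsum, CategoryTheory.sum_whiskerRight, CategoryTheory.whiskerLeft_sum,
        Preadditive.sum_comp, averaging, transpose_sum, Preadditive.sum_comp, Preadditive.comp_sum]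
      refine Finset.sum_congr rfl fun i _ => ?_
      rw [MonoidalLinear.smul_whiskerRight, MonoidalLinear.whiskerLeft_smul, Linear.smul_comp, h1,
        transpose_sum, Preadditive.sum_comp, Preadditive.comp_sum, Finset.smul_sum]
      refine Finset.sum_congr rfl fun a _ => ?_
      rw [transpose_smul, Linear.smul_comp, Linear.comp_smul, coevtUnit_mulHom]
    have hR : dinat hV (𝟙_ C) Y ≫ (Zev V ≫ Λ) ≫ Zπ V (𝟙_ C) j =
        dual Y ◁ (λ_ Y).hom ≫ S.transpose (c j • 𝟙 _) ≫ dual (V j) ◁ (λ_ (V j)).inv := by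
      rw [Category.assoc, hc, ← Category.assoc, dinat_Zev, transpose_smul, S.transpose_id,
        coevtUnit]
      simp
    rw [hΛ, hR] at hL
    exact ((cancel_mono _).1 ((cancel_epi _).1 hL)).symm
  obtain ⟨i₀, ⟨e⟩⟩ := hV.exists_unit
  have hd : rdim hV S i₀ = 1 := by
    rw [rdim, ← e.inv_hom_id, S.rightTrace_comm, e.hom_inv_id, S.rightTrace_unit, hV.scalar_one]
  refine ⟨c i₀, fun j => smul_coev_injective (j := j) hV ?_⟩
  -- Take Y = V_j and test on the coevaluation, regarded as a map out of `V i₀` ≅ 𝟙. Since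
  -- dim_r(V_{i₀}) = 1, the weight at `i₀` has the required form with t = `c i₀`.
  have h := comp_averaging hV S c (c i₀) (e.inv ≫ coev (V j)) (by rw [hd, mul_one])
  rw [key, Linear.comp_smul, Category.comp_id, ← Linear.comp_smul, ← Linear.comp_smul] at h
  exact (cancel_epi _).1 h

theorem isUnit_dim_of_isSemisimpleMonad (h : IsSemisimpleMonad (Zmonad hV)) :
    IsUnit (S.dim hV) := by
  obtain ⟨X, ⟨R⟩⟩ := h (unitModule hV)
  let i : 𝟙_ C ⟶ Zobj V X := R.i.f
  let r : Zobj V X ⟶ 𝟙_ C := R.r.f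
  have hi : Zmap V i ≫ Zmul hV X = Zev V ≫ i := R.i.h
  have hr : Zmap V r ≫ Zev V = Zmul hV X ≫ r := R.r.h
  have hir : i ≫ r = 𝟙 (𝟙_ C) := congrArg Monad.Algebra.Hom.f R.retract
  -- A module map out of a free module is determined by its restriction along the unit, so `r`
  -- factors as `Z(g)` followed by the action on 𝟙. This replaces the unknown `X` by 𝟙: `i ≫ Zmap V
  -- g` is a Z-linear section of `Zev`.
  let g : X ⟶ 𝟙_ C := Zunit hV X ≫ r
  have Zmap_comp {X Y W : C} (f : X ⟶ Y) (g : Y ⟶ W) : Zmap V (f ≫ g) = Zmap V f ≫ Zmap V g :=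
    (Zfunctor V).map_comp f g
  have hg : Zmap V g ≫ Zev V = r := by
    have hu : Zmap V (Zunit hV X) ≫ Zmul hV X = 𝟙 (Zobj V X) := (Zmonad hV).right_unit X
    rw [Zmap_comp, Category.assoc, hr, ← Category.assoc, hu, Category.id_comp]
  have hμ : Zmap V (Zmap V g) ≫ Zmul hV (𝟙_ C) = Zmul hV X ≫ Zmap V g := (Zmonad hV).μ.naturality g
  have hΛ : Zmap V (i ≫ Zmap V g) ≫ Zmul hV (𝟙_ C) = Zev V ≫ i ≫ Zmap V g := by
    rw [Zmap_comp, Category.assoc, hμ, ← Category.assoc, hi, Category.assoc]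
  have hΛ' : (i ≫ Zmap V g) ≫ Zev V = 𝟙 _ := by rw [Category.assoc, hg, hir]
  choose c hc using fun j => exists_eq_smul_coevtUnit S hV j ((i ≫ Zmap V g) ≫ Zπ V (𝟙_ C) j)
  obtain ⟨t, ht⟩ := coord_eq_of_linear hV S hΛ hc
  -- Closing the pairs in the section yields Σ c_j dim_l(V_j) = 1, and c_j = t dim_r(V_j) turns the
  -- sum into t · dim C.
  refine IsUnit.of_mul_eq_one_right t ?_
  apply hV.unit_bijective.1
  have hl (j) : coevtUnit S (V j) ≫ dual (V j) ◁ (λ_ (V j)).hom ≫ ev (V j) =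
      ldim hV S j • 𝟙 (𝟙_ C) := by
    rw [ldim, hV.scalar_smul, S.leftTrace_eq, coevtUnit]
    simp
  calc (t * S.dim hV) • 𝟙 (𝟙_ C) = ∑ j, (c j * ldim hV S j) • 𝟙 (𝟙_ C) := by
        rw [dim_eq, Finset.mul_sum, Finset.sum_smul]
        refine Finset.sum_congr rfl fun j _ => ?_
        rw [ht]
        ring_nf
    _ = (i ≫ Zmap V g) ≫ Zev V := by
        rw [Zev, Preadditive.comp_sum]
        refine Finset.sum_congr rfl fun j _ => ?_
        rw [← Category.assoc _ (Zπ V (𝟙_ C) j), hc, Linear.smul_comp, hl, smul_smul]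
    _ = (1 : k) • 𝟙 (𝟙_ C) := by rw [hΛ', one_smul]

end UnitModule

end SphericalFusion

end

/-- For a spherical fusion category, the monad `Z` (the monad of the center) is semisimple if and
only if the dimension of the category is invertible in the base ring. -/
theorem mainTheorem5 {k : Type w} [CommRing k] {C : Type u} [Category.{v} C] [Preadditive C]
    [Linear k C] [HasFiniteBiproducts C] [MonoidalCategory C] [MonoidalPreadditive C]
    [MonoidalLinear k C] [RightRigidCategory C]
    {ι : Type*} [Fintype ι] (V : ι → C) (hV : SphericalFusion.IsFusionFamily k V)
    (S : SphericalFusion.SovereignStructure C) (hS : S.IsSpherical) :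
    SphericalFusion.IsSemisimpleMonad (SphericalFusion.Zmonad hV) ↔ IsUnit (S.dim hV) :=
  ⟨SphericalFusion.isUnit_dim_of_isSemisimpleMonad hV S,
    SphericalFusion.isSemisimpleMonad_of_isUnit_dim hV S⟩
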